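/- \textbf{Setting.} Fix an integer $k\ge 1$ and a real number $V>0$. For each positive integer $\ell$ let $\mathcal A(\ell)$ be the space of weight $k$ holomorphic cusp forms on $\Gamma_0(\ell)$, with the Petersson inner product $$\langle f,g\rangle_\ell=\int_{\Gamma_0(\ell)\backslash\mathbb H}\overline{f(z)}\,g(z)\,y^k\,d\mu_\ell(z),$$ where $\mu_\ell$ is the multiple of $dx\,dy/y^2$ for which $\Gamma_0(\ell)\backslash\mathbb H$ has volume $V$. For $d\ge1$ put $\varphi|_d(z)=d^{k/2}\varphi(dz)$. The newspace $\mathcal A^*(q)$ is the orthogonal complement in $\mathcal A(q)$ of the span of all $\varphi|_d$ with $\ell\mid q$, $\ell\ne q$, $d\mid q/\ell$ and $\varphi\in\mathcal A(\ell)$. For $n\ge1$ let $$T_n\varphi(z)=n^{k-1}\sum_{ad=n}d^{-k}\sum_{b=0}^{d-1}\varphi\Bigl(\frac{az+b}{d}\Bigr).$$ \textbf{Statement.} Let $q\ge1$ be an integer divisible by the cube of every prime dividing it, and let $n\ge1$ be an integer coprime to $q$. Let $\Psi:\Gamma_0(q)\backslash\mathbb H\to\mathbb C$ be measurable and of moderate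 growth, i.e. there are real $C,A$ with $|\Psi(\gamma z)|\le C\,(\operatorname{Im} z)^A$ for all $\gamma\in \mathrm{SL}_2(\mathbb Z)$ and all $z$ in the standard fundamental domain $\{|z|\ge1,\ |\operatorname{Re}z|\le\tfrac12\}$ of $\mathrm{SL}_2(\mathbb Z)$. Let $\mathcal B^*(q)$ be any orthonormal basis of $\mathcal A^*(q)$ for $\langle\cdot,\cdot\rangle_q$, and for each $\ell\mid q$ let $\mathcal B(\ell)$ be any orthonormal basis of $\mathcal A(\ell)$ for $\langle\cdot,\cdot\rangle_\ell$. Then $$\sum_{\varphi\in\mathcal B^*(q)}\langle\varphi,\Psi\cdot T_n\varphi\rangle_q=\sum_{d,e\mid q}\mu(d)\mu(e)\sum_{\varphi\in\mathcal B(q/(de))}\bigl\langle\varphi|_d,\ \Psi\cdot T_n(\varphi|_d)\bigr\rangle_q ,$$ where $\mu$ is the M\"obius function, all the integrals occurring converge absolutely, and the terms with $\mu(d)\mu(e)=0$ are understood to be $0$ (for all others $de\mid q$). -/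

import Mathlib

/-!
Write `Γ(d, m)` for the conjugate of `Γ₀(m)` by `z ↦ d z`, so that the functions `φ|_d` with
`φ ∈ A(m)` are the cusp forms on `Γ(d, m)`, and let `P(d, m)` be the orthogonal projection of `A(q)`
to them. A diagonal sum `∑ S(w, w)` of a sesquilinear form over a finite family depends only on the
operator `∑ ⟨w, ·⟩ w`, so it is enough to prove that the isolator
`I = ∑ μ(d) μ(e) P(d, q / (d e))` is the projection to the newspace. All terms but
`d = e = 1` vanish on newforms, and `I` is self-adjoint, so it remains to see that `I` kills
oldforms.

If `G = G₁ G₂` as sets, then for a form `w` on `G₂` the normalized trace of `w` to `G` is its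
orthogonal projection both to the forms on `G` and to the forms on `G₁`. The oldspace is spanned by
forms raised by a prime `p ∣ q` and by forms of level `q / p`. For the former the terms of `d` and
`d p` cancel, and for the latter those of `e` and `e p`. In both cases the groups factor as needed
because `d e p` divides `q` for all squarefree `d` and `e`, and this is where cubes enter.
-/

open UpperHalfPlane MeasureTheory
open scoped MatrixGroups ModularForm Modular Pointwise

noncomputable section

namespace NewformIsolation

/-- The space `A(ℓ)` of holomorphic cusp forms of weight `k` on `Γ₀(ℓ)`, as a space of functions
on the upper half-plane. -/
def cuspSpace (k ℓ : ℕ) : Submodule ℂ (ℍ → ℂ) where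
  carrier := {f | ∃ F : CuspForm (CongruenceSubgroup.Gamma0 ℓ : Subgroup (GL (Fin 2) ℝ)) (k : ℤ),
    (F : ℍ → ℂ) = f}
  add_mem' := by
    rintro _ _ ⟨F, rfl⟩ ⟨G, rfl⟩
    exact ⟨F + G, rfl⟩
  zero_mem' := ⟨0, rfl⟩
  smul_mem' := by
    rintro c _ ⟨F, rfl⟩
    exact ⟨c • F, rfl⟩

/-- The operator `φ ↦ φ|_d`, where `φ|_d (z) = d ^ (k / 2) φ (d z)` (used for `d ≥ 1`). -/
def raise (k d : ℕ) (φ : ℍ → ℂ) : ℍ → ℂ :=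
  fun z => (((d : ℝ) ^ ((k : ℝ) / 2) : ℝ) : ℂ) * φ (ofComplex ((d : ℂ) * (z : ℂ)))

/-- The Hecke operator
`T_n φ (z) = n ^ (k - 1) ∑_{a d = n} d ^ (-k) ∑_{0 ≤ b < d} φ ((a z + b) / d)`. -/
def hecke (k n : ℕ) (φ : ℍ → ℂ) : ℍ → ℂ :=
  fun z => (n : ℂ) ^ ((k : ℤ) - 1) * ∑ d ∈ n.divisors, (d : ℂ) ^ (-(k : ℤ)) *
    ∑ b ∈ Finset.range d, φ (ofComplex ((((n / d : ℕ) : ℂ) * (z : ℂ) + (b : ℂ)) / (d : ℂ)))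

/-- A fundamental domain for `Γ₀(ℓ)` (up to overlaps of measure zero): the union of the translates
of the standard fundamental domain `𝒟` of `SL(2, ℤ)` by representatives of the right cosets
`Γ₀(ℓ) γ`, which are the inverses of representatives of the left cosets. -/
def fundDomain (ℓ : ℕ) : Set ℍ :=
  ⋃ c : SL(2, ℤ) ⧸ CongruenceSubgroup.Gamma0 ℓ, (Quotient.out c)⁻¹ • 𝒟

/-- The invariant measure on `Γ₀(ℓ) \ ℍ`, realized on a fundamental domain: the multiple of
`dx dy / y ^ 2` of total volume `V`. -/
def levelMeasure (V : ℝ) (ℓ : ℕ) : Measure ℍ :=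
  (ENNReal.ofReal V / volume (fundDomain ℓ)) • volume.restrict (fundDomain ℓ)

/-- The Petersson inner product
`⟨f, g⟩ = ∫_{Γ₀(ℓ) \ ℍ} conj (f z) g(z) y ^ k` against the measure of total volume `V`. -/
def peterssonInner (V : ℝ) (k ℓ : ℕ) (f g : ℍ → ℂ) : ℂ :=
  ∫ z, petersson (k : ℤ) f g z ∂(levelMeasure V ℓ)

/-- The oldspace of level `q`: the span of all `φ|_d` with `ℓ ≠ q` a divisor of `q`, `d` a divisor
of `q / ℓ`, and `φ ∈ A(ℓ)`. -/
def oldspace (k q : ℕ) : Submodule ℂ (ℍ → ℂ) :=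
  Submodule.span ℂ {f | ∃ ℓ d : ℕ, ℓ ∣ q ∧ ℓ ≠ q ∧ d ∣ q / ℓ ∧
    ∃ φ ∈ cuspSpace k ℓ, f = raise k d φ}

/-- The newspace `A*(q)`: the orthogonal complement of the oldspace in `A(q)`. -/
def newspace (V : ℝ) (k q : ℕ) : Set (ℍ → ℂ) :=
  {f | f ∈ cuspSpace k q ∧ ∀ g ∈ oldspace k q, peterssonInner V k q g f = 0}

/-- `B` is an orthonormal basis, for the Petersson inner product of level `ℓ`, of the space `W` of
functions. -/
structure IsOrthonormalBasis (V : ℝ) (k ℓ : ℕ) (W : Set (ℍ → ℂ)) (B : Finset (ℍ → ℂ)) : Prop where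
  norm_one : ∀ φ ∈ B, peterssonInner V k ℓ φ φ = 1
  orthogonal : ∀ φ ∈ B, ∀ ψ ∈ B, φ ≠ ψ → peterssonInner V k ℓ φ ψ = 0
  span_eq : (Submodule.span ℂ (B : Set (ℍ → ℂ)) : Set (ℍ → ℂ)) = W

/-- Moderate growth: at every cusp, polynomially bounded in the height. -/
def ModerateGrowth (Ψ : ℍ → ℂ) : Prop :=
  ∃ C A : ℝ, ∀ γ : SL(2, ℤ), ∀ z ∈ 𝒟, ‖Ψ (γ • z)‖ ≤ C * z.im ^ A

end NewformIsolation

end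

noncomputable section

namespace NewformIsolation

section CosetRepresentatives

variable {A P : Type*} [Group A] [Group P] {G H : Subgroup P} {ι : Type*} {r : ι → P}

/-- The family `r` takes values in `G` and represents each coset `H g` with `g ∈ G` exactly once,
so that `G` is the disjoint union of the cosets `H (r i)` if `H ≤ G`. -/
structure IsRightTransversal (G H : Subgroup P) (r : ι → P) : Prop where
  mem : ∀ i, r i ∈ G
  existsUnique_mul_inv_mem : ∀ g ∈ G, ∃! i, g * (r i)⁻¹ ∈ H

theorem IsRightTransversal.eq_of_mul_inv_mem (hr : IsRightTransversal G H r) {i j : ι}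
    (h : r i * (r j)⁻¹ ∈ H) : i = j :=
  (hr.existsUnique_mul_inv_mem _ (hr.mem i)).unique (by simp [H.one_mem]) h

theorem isRightTransversal_inv_out (f : A →* P) (H : Subgroup P) {K : Subgroup A}
    (hK : H.comap f = K) :
    IsRightTransversal f.range H fun c : A ⧸ K => f (Quotient.out c)⁻¹ where
  mem _ := ⟨_, rfl⟩
  existsUnique_mul_inv_mem := by
    rintro _ ⟨a, rfl⟩
    have mem_iff (c : A ⧸ K) : f a * (f (Quotient.out c)⁻¹)⁻¹ ∈ H ↔ (a⁻¹ : A) = c := by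
      rw [← map_inv, ← map_mul, ← Subgroup.mem_comap, hK, inv_inv]
      conv_rhs => rw [← QuotientGroup.out_eq' c, QuotientGroup.eq, inv_inv]
    exact ⟨_, (mem_iff _).2 rfl, fun c hc => ((mem_iff c).1 hc).symm⟩

theorem isRightTransversal_quotient (G H : Subgroup P) :
    IsRightTransversal G H fun c : G ⧸ H.subgroupOf G => (((Quotient.out c : G)⁻¹ : G) : P) := by
  have := isRightTransversal_inv_out G.subtype H rfl
  rwa [G.range_subtype] at this

end CosetRepresentatives

section Commensurability

open ConjAct Subgroup.Commensurable

variable {A P : Type*} [Group A] [Group P] {G H K : Subgroup P}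

theorem map_toConjAct_smul (f : A →* P) (a : A) (K : Subgroup A) :
    (toConjAct a • K).map f = toConjAct (f a) • K.map f := by
  ext x
  simp only [Subgroup.mem_map, Subgroup.mem_smul_pointwise_iff_exists, toConjAct_smul]
  constructor
  · rintro ⟨_, ⟨y, hy, rfl⟩, rfl⟩
    exact ⟨f y, ⟨y, hy, rfl⟩, by simp⟩
  · rintro ⟨_, ⟨y, hy, rfl⟩, rfl⟩
    exact ⟨_, ⟨y, hy, rfl⟩, by simp⟩

theorem relIndex_map_ne_zero (f : A →* P) {K L : Subgroup A} (h : K.relIndex L ≠ 0) :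
    (K.map f).relIndex (L.map f) ≠ 0 := by
  rw [← Subgroup.relIndex_comap]
  exact ne_zero_of_dvd_ne_zero h (Subgroup.relIndex_dvd_of_le_left L (Subgroup.le_comap_map f K))

theorem commensurable_map (f : A →* P) {K L : Subgroup A} (h : K.Commensurable L) :
    (K.map f).Commensurable (L.map f) :=
  ⟨relIndex_map_ne_zero f h.1, relIndex_map_ne_zero f h.2⟩

theorem mem_commensurator_of_mem_of_commensurable {g : P} (hg : g ∈ G) (h : G.Commensurable H) :
    g ∈ commensurator H := by
  rw [← h.eq, commensurator_mem_iff,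
    Subgroup.conjAct_pointwise_smul_eq_self (Subgroup.le_normalizer hg)]

end Commensurability

section InvariantMean

open ConjAct

variable {P α ι : Type*} [Group P] [MulAction P α] [MeasurableSpace α] {μ : Measure α}
  {G H K : Subgroup P} {D : Set α} {r : ι → P}

theorem aedisjoint_smul_smul (hD : IsFundamentalDomain G D μ) {g g' : P} (hg : g ∈ G) (hg' : g' ∈ G)
    (h : g ≠ g') : AEDisjoint μ (g • D) (g' • D) :=
  hD.aedisjoint (i := ⟨g, hg⟩) (j := ⟨g', hg'⟩) (by simpa using h)

theorem IsRightTransversal.pairwise_aedisjoint_smul (hr : IsRightTransversal G H r)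
    (hD : IsFundamentalDomain G D μ) :
    Pairwise (Function.onFun (AEDisjoint μ) fun i => r i • D) := fun i j hij =>
  aedisjoint_smul_smul hD (hr.mem i) (hr.mem j) fun h =>
    hij (hr.eq_of_mul_inv_mem (by simp [h, H.one_mem]))

variable [MeasurableConstSMul P α] [SMulInvariantMeasure P α μ]

theorem IsRightTransversal.isFundamentalDomain_iUnion_smul [Countable ι]
    (hr : IsRightTransversal G H r) (hHG : H ≤ G) (hD : IsFundamentalDomain G D μ) :
    IsFundamentalDomain H (⋃ i, r i • D) μ where
  nullMeasurableSet := .iUnion fun i => hD.nullMeasurableSet.smul (r i)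
  ae_covers := by
    filter_upwards [hD.ae_covers] with x ⟨g, hg⟩
    obtain ⟨i, hi, -⟩ := hr.existsUnique_mul_inv_mem _ (G.inv_mem g.2)
    refine ⟨⟨(r i * g : P), by simpa using H.inv_mem hi⟩, Set.mem_iUnion.2 ⟨i, ?_⟩⟩
    rw [Set.mem_smul_set_iff_inv_smul_mem]
    simpa [Subgroup.smul_def, mul_smul] using hg
  aedisjoint := by
    intro h h' hne
    simp only [Function.onFun, Subgroup.smul_def, Set.smul_set_iUnion, smul_smul]
    refine AEDisjoint.iUnion_left_iff.2 fun i => AEDisjoint.iUnion_right_iff.2 fun j => ?_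
    refine aedisjoint_smul_smul hD (G.mul_mem (hHG h.2) (hr.mem i))
      (G.mul_mem (hHG h'.2) (hr.mem j)) fun heq => hne ?_
    obtain rfl : i = j := hr.eq_of_mul_inv_mem (by
      have : r i * (r j)⁻¹ = (h : P)⁻¹ * h' := by
        rw [mul_inv_eq_iff_eq_mul, mul_assoc, ← heq, inv_mul_cancel_left]
      exact this ▸ H.mul_mem (H.inv_mem h.2) h'.2)
    exact Subtype.ext (mul_right_cancel heq)

theorem isFundamentalDomain_conj_smul (hD : IsFundamentalDomain K D μ) (g : P) :
    IsFundamentalDomain ↥(toConjAct g • K) (g • D) μ :=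
  hD.image_of_equiv (MulAction.toPerm g) (measurePreserving_smul g⁻¹ μ).quasiMeasurePreserving
    (Subgroup.equivSMul (toConjAct g) K).symm.toEquiv fun k x => by
      obtain ⟨k, rfl⟩ := (Subgroup.equivSMul (toConjAct g) K).surjective k
      simp [Subgroup.smul_def, toConjAct_smul, mul_smul]

variable {E : Type*} [NormedAddCommGroup E] {F : α → E}

theorem integrableOn_smul_set_iff (g : P) (D : Set α) (F : α → E) :
    IntegrableOn F (g • D) μ ↔ IntegrableOn (fun z => F (g • z)) D μ := by
  have := (measurePreserving_smul g μ).integrableOn_comp_preimage (f := F) (s := g • D)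
    (measurableEmbedding_const_smul g)
  rw [Set.preimage_smul, inv_smul_smul] at this
  exact this.symm

theorem IsRightTransversal.integrableOn_iUnion_smul [Finite ι] (hr : IsRightTransversal G H r)
    (hF : ∀ g ∈ G, ∀ z, F (g • z) = F z) (hint : IntegrableOn F D μ) :
    IntegrableOn F (⋃ i, r i • D) μ :=
  integrableOn_finite_iUnion.2 fun i =>
    (integrableOn_smul_set_iff _ _ _).2 (by simpa only [hF _ (hr.mem i)] using hint)

variable [NormedSpace ℝ E] {m : E}

theorem setIntegral_smul_set (g : P) (D : Set α) (F : α → E) :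
    ∫ z in g • D, F z ∂μ = ∫ z in D, F (g • z) ∂μ := by
  rw [← (measurePreserving_smul g μ).setIntegral_preimage_emb (measurableEmbedding_const_smul g),
    Set.preimage_smul, inv_smul_smul]

theorem setAverage_smul_set (g : P) (D : Set α) (F : α → E) :
    ⨍ z in g • D, F z ∂μ = ⨍ z in D, F (g • z) ∂μ := by
  rw [setAverage_eq, setAverage_eq, setIntegral_smul_set, measureReal_def, measureReal_def,
    measure_smul]

theorem IsRightTransversal.setAverage_iUnion_smul [Finite ι] [Nonempty ι]
    (hr : IsRightTransversal G H r) (hD : IsFundamentalDomain G D μ)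
    (hF : ∀ g ∈ G, ∀ z, F (g • z) = F z) (hint : IntegrableOn F D μ) :
    ⨍ z in ⋃ i, r i • D, F z ∂μ = ⨍ z in D, F z ∂μ := by
  have := Fintype.ofFinite ι
  have integral_eq : ∫ z in ⋃ i, r i • D, F z ∂μ = (Fintype.card ι : ℝ) • ∫ z in D, F z ∂μ := by
    rw [integral_iUnion_ae (fun i => hD.nullMeasurableSet.smul (r i))
      (hr.pairwise_aedisjoint_smul hD) (hr.integrableOn_iUnion_smul hF hint), tsum_fintype]
    simp_rw [setIntegral_smul_set, hF _ (hr.mem _)]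
    simp [Nat.cast_smul_eq_nsmul]
  have measure_eq : μ (⋃ i, r i • D) = Fintype.card ι * μ D := by
    rw [measure_iUnion₀ (hr.pairwise_aedisjoint_smul hD) (fun i => hD.nullMeasurableSet.smul (r i)),
      tsum_fintype]
    simp
  rw [setAverage_eq, setAverage_eq, integral_eq, measureReal_def, measureReal_def, measure_eq,
    ENNReal.toReal_mul, ENNReal.toReal_natCast, smul_smul]
  congr 1
  field_simp

/-- The function `F` is `G`-invariant, and integrable with average `m` over `G \ α`, which is
realized by a fundamental domain. -/
structure HasInvariantMean (μ : Measure α) (G : Subgroup P) (F : α → E) (m : E) : Prop where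
  smul_eq : ∀ g ∈ G, ∀ z, F (g • z) = F z
  exists_setAverage_eq : ∃ D, IsFundamentalDomain G D μ ∧ IntegrableOn F D μ ∧ ⨍ z in D, F z ∂μ = m

namespace HasInvariantMean

theorem integrableOn_and_setAverage_eq [Countable G] (h : HasInvariantMean μ G F m)
    (hD : IsFundamentalDomain G D μ) : IntegrableOn F D μ ∧ ⨍ z in D, F z ∂μ = m := by
  obtain ⟨hF, D', hD', hint, rfl⟩ := h
  have hF' : ∀ (g : G) z, F (g • z) = F z := fun g => hF g g.2
  refine ⟨(hD.integrableOn_iff hD' hF').2 hint, ?_⟩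
  rw [setAverage_eq, setAverage_eq, hD.setIntegral_eq hD' hF', measureReal_def, measureReal_def,
    hD.measure_eq hD']

theorem of_le (h : HasInvariantMean μ G F m) (hHG : H ≤ G) (hfin : H.relIndex G ≠ 0) :
    HasInvariantMean μ H F m := by
  obtain ⟨hF, D, hD, hint, rfl⟩ := h
  have : Finite (G ⧸ H.subgroupOf G) := Nat.finite_of_card_ne_zero hfin
  have hr := isRightTransversal_quotient G H
  exact ⟨fun g hg => hF g (hHG hg), _, hr.isFundamentalDomain_iUnion_smul hHG hD,
    hr.integrableOn_iUnion_smul hF hint, hr.setAverage_iUnion_smul hD hF hint⟩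

theorem eq_of_commensurable [Countable G] {m' : E} (h : HasInvariantMean μ G F m)
    (h' : HasInvariantMean μ H F m') (hGH : G.Commensurable H) : m = m' := by
  have : Countable ↥(G ⊓ H) :=
    (Subgroup.inclusion_injective (inf_le_left : G ⊓ H ≤ G)).countable
  have h := h.of_le inf_le_left (by rw [Subgroup.inf_relIndex_left]; exact hGH.2)
  have h' := h'.of_le inf_le_right (by rw [Subgroup.inf_relIndex_right]; exact hGH.1)
  obtain ⟨D, hD, -, rfl⟩ := h'.exists_setAverage_eq
  exact (h.integrableOn_and_setAverage_eq hD).2.symm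

theorem comp_smul (h : HasInvariantMean μ G F m) (g : P) :
    HasInvariantMean μ (toConjAct g⁻¹ • G) (fun z => F (g • z)) m := by
  obtain ⟨hF, D, hD, hint, rfl⟩ := h
  refine ⟨?_, g⁻¹ • D, isFundamentalDomain_conj_smul hD g⁻¹, ?_, ?_⟩
  · rintro _ ⟨y, hy, rfl⟩ z
    simpa only [MulDistribMulAction.toMonoidEnd_apply, MulDistribMulAction.toMonoidHom_apply,
      toConjAct_inv_smul, mul_smul, smul_inv_smul] using hF y hy (g • z)
  · simpa [integrableOn_smul_set_iff] using hint
  · simp [setAverage_smul_set]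

theorem sum [Countable G] {s : Finset ι} {F : ι → α → E} {m : ι → E}
    (hD : IsFundamentalDomain G D μ)
    (h : ∀ i ∈ s, HasInvariantMean μ G (F i) (m i)) :
    HasInvariantMean μ G (fun z => ∑ i ∈ s, F i z) (∑ i ∈ s, m i) := by
  have hmean i (hi : i ∈ s) := (h i hi).integrableOn_and_setAverage_eq hD
  refine ⟨fun g hg z => Finset.sum_congr rfl fun i hi => (h i hi).smul_eq g hg z, D, hD,
    integrable_finsetSum s fun i hi => (hmean i hi).1, ?_⟩
  rw [setAverage_eq, integral_finsetSum s fun i hi => (hmean i hi).1, Finset.smul_sum]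
  exact Finset.sum_congr rfl fun i hi => by rw [← setAverage_eq, (hmean i hi).2]

/-- Each `F (r i • ·)` is invariant under a conjugate of `G`, and these finitely many conjugates
have an intersection of finite index in `G`, on which the means can be compared. -/
theorem eq_card_smul_of_sum_comp_smul [Fintype ι] [Countable G] (h : HasInvariantMean μ G F m)
    (hr : ∀ i, r i ∈ Subgroup.Commensurable.commensurator G) {m' : E}
    (h' : HasInvariantMean μ G (fun z => ∑ i, F (r i • z)) m') : m' = Fintype.card ι • m := by
  set K : Subgroup P := G ⊓ ⨅ i, toConjAct (r i)⁻¹ • G with hK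
  have : Countable K := (Subgroup.inclusion_injective (inf_le_left : K ≤ G)).countable
  have hcomm (i : ι) : (toConjAct (r i)⁻¹ • G).Commensurable G :=
    (Subgroup.Commensurable.commensurator_mem_iff G _).1 (inv_mem (hr i))
  have hKG : K.relIndex G ≠ 0 := by
    rw [hK, Subgroup.inf_relIndex_left]
    exact Subgroup.relIndex_iInf_ne_zero fun i => (hcomm i).1
  have hKi (i : ι) : HasInvariantMean μ K (fun z => F (r i • z)) m :=
    (h.comp_smul (r i)).of_le (inf_le_right.trans (iInf_le _ i))
      (Subgroup.relIndex_ne_zero_trans hKG (hcomm i).2)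
  obtain ⟨D, hD, -, -⟩ := (h.of_le inf_le_left hKG).exists_setAverage_eq
  have hsum := sum (s := Finset.univ) hD fun i _ => hKi i
  simpa using (h'.of_le inf_le_left hKG).eq_of_commensurable hsum (.refl K)

end HasInvariantMean

end InvariantMean

section Mobius

open Matrix.SpecialLinearGroup (mapGL)

/-- The group of the transformations of the upper half-plane given by real matrices. Unlike the
group of the matrices it acts faithfully, as needed for fundamental domains. -/
abbrev MobiusGroup : Type := (MulAction.toPermHom (GL (Fin 2) ℝ) ℍ).range

/-- The transformation of the upper half-plane given by a matrix. -/
def toMobius : GL (Fin 2) ℝ →* MobiusGroup := (MulAction.toPermHom (GL (Fin 2) ℝ) ℍ).rangeRestrict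

theorem toMobius_smul (g : GL (Fin 2) ℝ) (z : ℍ) : toMobius g • z = g • z := rfl

theorem toMobius_surjective : Function.Surjective toMobius := MonoidHom.rangeRestrict_surjective _

instance : MeasurableConstSMul (GL (Fin 2) ℝ) ℍ :=
  ⟨fun g => (continuous_const_smul g).measurable⟩

instance : MeasurableConstSMul MobiusGroup ℍ := ⟨fun g => by
  obtain ⟨g, rfl⟩ := toMobius_surjective g
  exact measurable_const_smul g⟩

instance : SMulInvariantMeasure MobiusGroup ℍ volume := ⟨fun g s hs => by
  obtain ⟨g, rfl⟩ := toMobius_surjective g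
  exact measure_preimage_smul_of_nullMeasurableSet (G := GL (Fin 2) ℝ) hs.nullMeasurableSet g⟩

theorem toMobius_mapGL_eq_iff (g h : SL(2, ℤ)) :
    toMobius (mapGL ℝ g) = toMobius (mapGL ℝ h) ↔ g = h ∨ g = -h := by
  constructor
  · intro heq
    have smul_eq (z : ℍ) : g • z = h • z := congrArg (fun x : MobiusGroup => x • z) heq
    have two_I_mem : (⟨2 * Complex.I, by simp⟩ : ℍ) ∈ 𝒟ᵒ := ⟨by norm_num, by simp [re]⟩
    rcases ModularGroup.eq_one_or_neg_one_of_mem_fdo_mem_fdo (g := h⁻¹ * g) two_I_mem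
      (by rwa [mul_smul, smul_eq, inv_smul_smul]) with h1 | h1
    · exact .inl (inv_mul_eq_one.1 h1).symm
    · exact .inr (by simpa [inv_mul_eq_iff_eq_mul] using h1)
  · rintro (rfl | rfl)
    · rfl
    · exact Subtype.ext (Equiv.ext (ModularGroup.SL_neg_smul h))

theorem volume_setOf_re_eq (c : ℝ) : volume {z : ℍ | z.re = c} = 0 := by
  rw [volume_eq_lintegral]
  refine setLIntegral_measure_zero _ _ (measure_mono_null (t := {z : ℂ | z.re = c}) ?_ ?_)
  · rintro _ ⟨z, hz, rfl⟩
    exact hz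
  · have h := Complex.volume_preserving_equiv_real_prod.measure_preimage_equiv ({c} ×ˢ Set.univ)
    rw [Measure.volume_eq_prod, Measure.prod_prod, measure_singleton, zero_mul] at h
    rw [← h]
    congr 1
    ext z
    simp [Complex.measurableEquivRealProd]

theorem volume_setOf_norm_eq (c : ℝ) : volume {z : ℍ | ‖(z : ℂ)‖ = c} = 0 := by
  rw [volume_eq_lintegral]
  refine setLIntegral_measure_zero _ _ (measure_mono_null (t := Metric.sphere (0 : ℂ) c) ?_ ?_)
  · rintro _ ⟨z, hz, rfl⟩
    simpa using hz
  · exact Measure.addHaar_sphere _ _ _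

theorem volume_fd_diff_fdo : volume (𝒟 \ 𝒟ᵒ) = 0 := by
  refine measure_mono_null (t := {z : ℍ | ‖(z : ℂ)‖ = 1} ∪
    ({z : ℍ | z.re = 1 / 2} ∪ {z : ℍ | z.re = -(1 / 2)})) ?_
    (by simp only [measure_union_null_iff, volume_setOf_norm_eq, volume_setOf_re_eq, and_self])
  rintro z ⟨⟨hnorm, hre⟩, hfdo⟩
  rcases hnorm.eq_or_lt with hnorm | hnorm
  · refine .inl ((sq_eq_sq₀ (norm_nonneg _) zero_le_one).1 ?_)
    rw [← Complex.normSq_eq_norm_sq, ← hnorm, one_pow]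
  · exact .inr (eq_or_eq_neg_of_abs_eq (hre.antisymm (not_lt.1 fun h => hfdo ⟨hnorm, h⟩)))

theorem isFundamentalDomain_fd :
    IsFundamentalDomain ((𝒮ℒ : Subgroup (GL (Fin 2) ℝ)).map toMobius) 𝒟 volume := by
  refine .mk'' ModularGroup.isClosed_fd.measurableSet.nullMeasurableSet (.of_forall fun z => ?_)
    (fun g hg => ?_)
    (fun g => (measurePreserving_smul (g : MobiusGroup) volume).quasiMeasurePreserving)
  · obtain ⟨g, hg⟩ := ModularGroup.exists_smul_mem_fd z
    exact ⟨⟨toMobius (mapGL ℝ g), _, ⟨g, rfl⟩, rfl⟩, hg⟩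
  · obtain ⟨_, _, ⟨g, rfl⟩, rfl⟩ := g
    refine measure_mono_null (t := (𝒟 \ 𝒟ᵒ) ∪ toMobius (mapGL ℝ g) • (𝒟 \ 𝒟ᵒ)) ?_
      (by simp only [measure_union_null_iff, measure_smul, volume_fd_diff_fdo, and_self])
    rintro z ⟨⟨w, hw, rfl⟩, hz⟩
    by_cases hw' : w ∈ 𝒟ᵒ
    · refine absurd (ModularGroup.eq_one_or_neg_one_of_mem_fdo_mem_fd hw' hz) fun h => hg ?_
      have heq := (toMobius_mapGL_eq_iff g 1).2 h
      rw [map_one, map_one] at heq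
      exact Subtype.ext heq
    · exact .inr ⟨w, ⟨hw, hw'⟩, rfl⟩

theorem lintegral_Ioi_one_div_sq_lt_top {c : ℝ} (hc : 0 < c) :
    ∫⁻ y in Set.Ioi c, (((1 / ‖y‖₊) ^ 2 : NNReal) : ENNReal) < ⊤ := by
  have hint := (integrableOn_Ioi_rpow_of_lt (a := -2) (by norm_num) hc).2
  refine lt_of_eq_of_lt (setLIntegral_congr_fun measurableSet_Ioi fun y hy => ?_) hint
  have hy : 0 < y := hc.trans hy
  rw [enorm_eq_nnnorm, ENNReal.coe_inj]
  ext
  rw [coe_nnnorm, Real.norm_of_nonneg (Real.rpow_nonneg hy.le _)]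
  simp [Real.rpow_neg hy.le]

theorem volume_setOf_abs_re_le_lt_im_lt_top (a : ℝ) {c : ℝ} (hc : 0 < c) :
    volume {z : ℍ | |z.re| ≤ a ∧ c < z.im} < ⊤ := by
  have hf : Measurable fun y : ℝ => (((1 / ‖y‖₊) ^ 2 : NNReal) : ENNReal) := by fun_prop
  rw [volume_eq_lintegral]
  calc ∫⁻ z in (↑) '' {z : ℍ | |z.re| ≤ a ∧ c < z.im},
          (((1 / ‖(z : ℂ).im‖₊) ^ 2 : NNReal) : ENNReal)
      ≤ ∫⁻ z in Complex.measurableEquivRealProd ⁻¹' (Set.Icc (-a) a ×ˢ Set.Ioi c),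
          (((1 / ‖(z : ℂ).im‖₊) ^ 2 : NNReal) : ENNReal) := by
        refine lintegral_mono_set ?_
        rintro _ ⟨z, hz, rfl⟩
        exact ⟨abs_le.1 hz.1, hz.2⟩
    _ = ∫⁻ p in Set.Icc (-a) a ×ˢ Set.Ioi c, (((1 / ‖p.2‖₊) ^ 2 : NNReal) : ENNReal) :=
        Complex.volume_preserving_equiv_real_prod.setLIntegral_comp_preimage_emb
          Complex.measurableEquivRealProd.measurableEmbedding
          (fun p : ℝ × ℝ => (((1 / ‖p.2‖₊) ^ 2 : NNReal) : ENNReal)) _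
    _ = (∫⁻ _ in Set.Icc (-a) a, 1) *
          ∫⁻ y in Set.Ioi c, (((1 / ‖y‖₊) ^ 2 : NNReal) : ENNReal) := by
        rw [Measure.volume_eq_prod, ← Measure.prod_restrict,
          ← lintegral_prod_mul (by fun_prop) hf.aemeasurable]
        simp only [one_mul]
    _ < ⊤ := ENNReal.mul_lt_top (by simp) (lintegral_Ioi_one_div_sq_lt_top hc)

theorem volume_fd_lt_top : volume 𝒟 < ⊤ := by
  refine (measure_mono fun z hz => ?_).trans_lt
    (volume_setOf_abs_re_le_lt_im_lt_top (1 / 2) one_half_pos)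
  have := ModularGroup.three_le_four_mul_im_sq_of_mem_fd hz
  exact ⟨hz.2, by nlinarith [z.im_pos]⟩

end Mobius

section Levels

open Matrix.SpecialLinearGroup (mapGL)

variable {ℓ : ℕ}

/-- The group `Γ₀(ℓ)` as a group of real matrices. -/
abbrev gamma0 (ℓ : ℕ) : Subgroup (GL (Fin 2) ℝ) := (CongruenceSubgroup.Gamma0 ℓ).map (mapGL ℝ)

/-- The group `Γ₀(ℓ)` as a group of transformations of the upper half-plane. -/
abbrev mobiusGamma0 (ℓ : ℕ) : Subgroup MobiusGroup := (gamma0 ℓ).map toMobius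

theorem comap_mobiusGamma0 (ℓ : ℕ) :
    (mobiusGamma0 ℓ).comap (toMobius.comp (mapGL ℝ)) = CongruenceSubgroup.Gamma0 ℓ := by
  ext g
  constructor
  · rintro ⟨_, ⟨h, hh, rfl⟩, heq⟩
    rcases (toMobius_mapGL_eq_iff h g).1 heq with rfl | rfl
    · exact hh
    · simpa [CongruenceSubgroup.Gamma0_mem] using hh
  · exact fun hg => ⟨_, ⟨g, hg, rfl⟩, rfl⟩

theorem isRightTransversal_mobiusGamma0 (ℓ : ℕ) :
    IsRightTransversal ((𝒮ℒ : Subgroup (GL (Fin 2) ℝ)).map toMobius) (mobiusGamma0 ℓ)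
      fun c : SL(2, ℤ) ⧸ CongruenceSubgroup.Gamma0 ℓ =>
        toMobius.comp (mapGL ℝ) (Quotient.out c)⁻¹ := by
  rw [MonoidHom.map_range]
  exact isRightTransversal_inv_out _ _ (comap_mobiusGamma0 ℓ)

instance : Countable SL(2, ℤ) :=
  inferInstanceAs (Countable {A : Fin 2 → Fin 2 → ℤ // Matrix.det (Matrix.of A) = 1})

instance (ℓ : ℕ) : Countable (mobiusGamma0 ℓ) :=
  ((Set.to_countable _).image (mapGL ℝ) |>.image toMobius).to_subtype

theorem isFundamentalDomain_fundDomain (ℓ : ℕ) :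
    IsFundamentalDomain (mobiusGamma0 ℓ) (fundDomain ℓ) volume := by
  have : Countable (SL(2, ℤ) ⧸ CongruenceSubgroup.Gamma0 ℓ) := Quotient.countable
  refine (isRightTransversal_mobiusGamma0 ℓ).isFundamentalDomain_iUnion_smul
    (Subgroup.map_mono ?_) isFundamentalDomain_fd
  rintro _ ⟨g, -, rfl⟩
  exact ⟨g, rfl⟩

theorem volume_fundDomain_lt_top (ℓ : ℕ) [NeZero ℓ] : volume (fundDomain ℓ) < ⊤ := by
  have : Finite (SL(2, ℤ) ⧸ CongruenceSubgroup.Gamma0 ℓ) :=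
    Subgroup.finite_quotient_of_finiteIndex
  have := Fintype.ofFinite (SL(2, ℤ) ⧸ CongruenceSubgroup.Gamma0 ℓ)
  refine (measure_iUnion_le _).trans_lt ?_
  rw [tsum_fintype]
  refine ENNReal.sum_lt_top.2 fun c _ => ?_
  change volume (toMobius (mapGL ℝ (Quotient.out c)⁻¹) • 𝒟) < ⊤
  rw [measure_smul]
  exact volume_fd_lt_top

theorem peterssonInner_eq_mul_setAverage {V : ℝ} (hV : 0 < V) (k ℓ : ℕ) (f g : ℍ → ℂ) :
    peterssonInner V k ℓ f g = (V : ℂ) * ⨍ z in fundDomain ℓ, petersson k f g z := by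
  rw [peterssonInner, levelMeasure, integral_smul_measure, setAverage_eq, ENNReal.toReal_div,
    ENNReal.toReal_ofReal hV.le, div_eq_mul_inv, mul_smul, measureReal_def, Complex.real_smul]

theorem integrable_levelMeasure_of_integrableOn (V : ℝ) {F : ℍ → ℂ}
    (hF : IntegrableOn F (fundDomain ℓ)) : Integrable F (levelMeasure V ℓ) := by
  by_cases h0 : volume (fundDomain ℓ) = 0
  · rw [levelMeasure, Measure.restrict_eq_zero.2 h0, smul_zero]
    exact integrable_zero_measure
  · exact hF.smul_measure (ENNReal.div_ne_top ENNReal.ofReal_ne_top h0)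

end Levels

section AffineMaps

/-- The rational matrix of `z ↦ a z + b` for `a ≠ 0`, and the identity for `a = 0`. -/
def affineMatrix (a b : ℚ) : GL (Fin 2) ℚ :=
  if h : a = 0 then 1 else Matrix.GeneralLinearGroup.mkOfDetNeZero !![a, b; 0, 1] (by simpa using h)

/-- The matrix of `z ↦ a z + b` acting on the upper half-plane, for rational `a` and `b`. -/
def affineMap (a b : ℚ) : GL (Fin 2) ℝ := (affineMatrix a b).map (Rat.castHom ℝ)

variable {a : ℚ} (b : ℚ)

theorem affineMap_val (ha : a ≠ 0) : (affineMap a b).val = !![(a : ℝ), (b : ℝ); 0, 1] := by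
  ext i j
  fin_cases i <;> fin_cases j <;>
    simp [affineMap, affineMatrix, ha, Matrix.GeneralLinearGroup.mkOfDetNeZero]

theorem affineMap_one_zero : affineMap 1 0 = 1 := by
  ext i j
  rw [affineMap_val _ one_ne_zero]
  fin_cases i <;> fin_cases j <;> simp

theorem det_affineMap (ha : a ≠ 0) : (affineMap a b).det.val = (a : ℝ) := by
  rw [Matrix.GeneralLinearGroup.val_det_apply, affineMap_val b ha]
  simp

theorem denom_affineMap (ha : a ≠ 0) (z : ℂ) : denom (affineMap a b) z = 1 := by
  simp [denom, affineMap_val b ha]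

theorem coe_affineMap_smul (ha : 0 < a) (z : ℍ) : ((affineMap a b • z : ℍ) : ℂ) = a * z + b := by
  rw [coe_smul_of_det_pos (by rw [det_affineMap b ha.ne']; exact_mod_cast ha),
    denom_affineMap b ha.ne']
  simp [num, affineMap_val b ha.ne']

theorem im_affineMap_smul (ha : 0 < a) (z : ℍ) : (affineMap a b • z).im = a * z.im := by
  simpa using congrArg Complex.im (coe_affineMap_smul b ha z)

theorem ofComplex_mul_add (ha : 0 < a) (z : ℍ) :
    ofComplex ((a : ℂ) * (z : ℂ) + (b : ℂ)) = affineMap a b • z := by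
  rw [← coe_affineMap_smul b ha, ofComplex_apply]

theorem slash_affineMap (ha : 0 < a) (k : ℤ) (f : ℍ → ℂ) (z : ℍ) :
    (f ∣[k] affineMap a b) z = (a : ℂ) ^ (k - 1) * f (affineMap a b • z) := by
  have ha' : (0 : ℝ) < a := by exact_mod_cast ha
  have hσ : σ (affineMap a b) = .refl ℝ ℂ := by
    rw [σ, if_pos (by rwa [det_affineMap b ha.ne'])]
  rw [ModularForm.slash_apply, denom_affineMap b ha.ne', det_affineMap b ha.ne', abs_of_pos ha', hσ]
  simp [mul_comm]

end AffineMaps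

section Raise

variable {k d e m : ℕ}

theorem raise_apply (hd : d ≠ 0) (φ : ℍ → ℂ) (z : ℍ) :
    raise k d φ z = (((d : ℝ) ^ ((k : ℝ) / 2) : ℝ) : ℂ) * φ (affineMap d 0 • z) := by
  have := ofComplex_mul_add (a := d) 0 (by positivity) z
  simp only [Rat.cast_natCast, Rat.cast_zero, add_zero] at this
  rw [raise, this]

/-- The operator `φ ↦ φ|_d` as a linear map. -/
def raiseHom (k d : ℕ) : (ℍ → ℂ) →ₗ[ℂ] (ℍ → ℂ) where
  toFun := raise k d
  map_add' φ ψ := by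
    ext z
    simp [raise, mul_add]
  map_smul' c φ := by
    ext z
    simp [raise, mul_left_comm]

theorem raise_smul (c : ℂ) (φ : ℍ → ℂ) : raise k d (c • φ) = c • raise k d φ :=
  map_smul (raiseHom k d) c φ

theorem raise_raise (hd : d ≠ 0) (he : e ≠ 0) (φ : ℍ → ℂ) :
    raise k d (raise k e φ) = raise k (d * e) φ := by
  have hd' : (0 : ℚ) < d := by positivity
  have he' : (0 : ℚ) < e := by positivity
  ext z
  rw [raise_apply hd, raise_apply he, raise_apply (mul_ne_zero hd he), ← mul_assoc]
  congr 2
  · rw [← Complex.ofReal_mul, ← Real.mul_rpow (by positivity) (by positivity), Nat.cast_mul]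
  · apply UpperHalfPlane.ext
    rw [coe_affineMap_smul _ he', coe_affineMap_smul _ hd', coe_affineMap_smul _ (by positivity)]
    push_cast
    ring

theorem petersson_raise (hd : d ≠ 0) (f g : ℍ → ℂ) (z : ℍ) :
    petersson k (raise k d f) (raise k d g) z = petersson k f g (affineMap d 0 • z) := by
  have rpow_half_mul_self : ((((d : ℝ) ^ ((k : ℝ) / 2) : ℝ) : ℂ)) *
      (((d : ℝ) ^ ((k : ℝ) / 2) : ℝ) : ℂ) = (d : ℂ) ^ k := by
    rw [← Complex.ofReal_mul, ← Real.rpow_add (by positivity), add_halves, Real.rpow_natCast,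
      Complex.ofReal_pow, Complex.ofReal_natCast]
  rw [petersson, petersson, raise_apply hd, raise_apply hd, im_affineMap_smul _ (by positivity)]
  simp only [map_mul, Complex.conj_ofReal, Complex.ofReal_mul, Rat.cast_natCast,
    Complex.ofReal_natCast, zpow_natCast, mul_pow, ← rpow_half_mul_self]
  ring

theorem raise_eq_smul_slash (hd : d ≠ 0) (φ : ℍ → ℂ) :
    raise k d φ = ((((d : ℝ) ^ ((k : ℝ) / 2) : ℝ) : ℂ) / (d : ℂ) ^ ((k : ℤ) - 1)) •
      (φ ∣[(k : ℤ)] affineMap d 0) := by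
  have hd' : (d : ℂ) ≠ 0 := by exact_mod_cast hd
  ext z
  rw [Pi.smul_apply, slash_affineMap _ (by positivity), raise_apply hd, smul_eq_mul,
    Rat.cast_natCast, ← mul_assoc, div_mul_cancel₀ _ (zpow_ne_zero _ hd')]

end Raise

section LevelGroups

open Matrix.SpecialLinearGroup (mapGL)
open ConjAct

variable {d m q : ℕ} {g : GL (Fin 2) ℝ}

theorem mem_gamma0_iff : g ∈ gamma0 m ↔ ∃ a b c e : ℤ, a * e - b * (c * m) = 1 ∧
    g.val = !![(a : ℝ), b; c * m, (e : ℝ)] := by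
  constructor
  · rintro ⟨h, hh, rfl⟩
    obtain ⟨c, hc⟩ := (ZMod.intCast_zmod_eq_zero_iff_dvd _ _).1 (CongruenceSubgroup.Gamma0_mem.1 hh)
    have hdet := h.det_coe
    rw [Matrix.det_fin_two, hc] at hdet
    refine ⟨h 0 0, h 0 1, c, h 1 1, by linear_combination hdet, ?_⟩
    ext i j
    fin_cases i <;> fin_cases j <;> simp [hc, mul_comm]
  · rintro ⟨a, b, c, e, hdet, hg⟩
    obtain ⟨h, hh⟩ : ∃ h : SL(2, ℤ), h.val = !![a, b; c * m, e] :=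
      ⟨⟨_, by rwa [Matrix.det_fin_two_of]⟩, rfl⟩
    refine ⟨h, CongruenceSubgroup.Gamma0_mem.2 (by simp [hh]), ?_⟩
    ext i j
    rw [hg, Matrix.SpecialLinearGroup.mapGL_coe_matrix]
    fin_cases i <;> fin_cases j <;> simp [hh]

/-- The group `δ⁻¹ Γ₀(m) δ`, where `δ z = d z`, consisting of the matrices `(a, b / d; c m d, e)` of
determinant one with integers `a`, `b`, `c` and `e`. -/
def levelGroup (d m : ℕ) : Subgroup (GL (Fin 2) ℝ) := toConjAct (affineMap d 0)⁻¹ • gamma0 m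

instance (d m : ℕ) : (levelGroup d m).HasDetOne := by
  unfold levelGroup
  infer_instance

instance (d m : ℕ) [NeZero m] : (levelGroup d m).IsArithmetic := by
  have := Subgroup.IsArithmetic.conj (gamma0 m) (affineMatrix d 0)⁻¹
  rwa [map_inv] at this

theorem mem_levelGroup_iff_conj_mem :
    g ∈ levelGroup d m ↔ affineMap d 0 * g * (affineMap d 0)⁻¹ ∈ gamma0 m := by
  rw [levelGroup, Subgroup.mem_pointwise_smul_iff_inv_smul_mem, ← map_inv, inv_inv, toConjAct_smul]

theorem conj_affineMap_val_eq_iff (hd : d ≠ 0) {a b c e : ℝ} :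
    (affineMap d 0 * g * (affineMap d 0)⁻¹).val = !![a, b; c, e] ↔
      g.val = !![a, b / d; c * d, e] := by
  have hd' : (d : ℝ) ≠ 0 := by exact_mod_cast hd
  rw [Units.val_mul, Units.val_mul, Units.mul_inv_eq_iff_eq_mul,
    affineMap_val _ (by exact_mod_cast hd), Matrix.eta_fin_two g.val]
  simp only [← Matrix.ext_iff, Fin.forall_fin_two, Matrix.mul_apply, Fin.sum_univ_two]
  simp [mul_comm _ (d : ℝ), hd', eq_div_iff]

theorem mem_levelGroup_iff (hd : d ≠ 0) :
    g ∈ levelGroup d m ↔ ∃ a b c e : ℤ, a * e - b * (c * m) = 1 ∧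
      g.val = !![(a : ℝ), b / d; c * m * d, (e : ℝ)] := by
  simp only [mem_levelGroup_iff_conj_mem, mem_gamma0_iff, conj_affineMap_val_eq_iff hd]

theorem levelGroup_one (m : ℕ) : levelGroup 1 m = gamma0 m := by
  rw [levelGroup, Nat.cast_one, affineMap_one_zero, inv_one, map_one, one_smul]

theorem levelGroup_mono {d' m' : ℕ} (hd' : d' ≠ 0) (hdvd : d ∣ d') (hmul : d' * m' ∣ d * m) :
    levelGroup d m ≤ levelGroup d' m' := by
  obtain ⟨x, rfl⟩ := hdvd
  obtain ⟨hd, hx⟩ := mul_ne_zero_iff.1 hd'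
  have hdr : (d : ℝ) ≠ 0 := by exact_mod_cast hd
  have hxr : (x : ℝ) ≠ 0 := by exact_mod_cast hx
  obtain ⟨y, rfl⟩ : x * m' ∣ m :=
    (Nat.mul_dvd_mul_iff_left (Nat.pos_of_ne_zero hd)).1 (by rwa [← mul_assoc])
  intro g hg
  obtain ⟨a, b, c, e, hdet, hg⟩ := (mem_levelGroup_iff hd).1 hg
  refine (mem_levelGroup_iff hd').2 ⟨a, b * x, c * y, e, ?_, ?_⟩
  · rw [← hdet]
    push_cast
    ring
  · rw [hg]
    ext i j
    fin_cases i <;> fin_cases j <;> simp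
    · field_simp
    · ring

theorem gamma0_le_levelGroup (hd : d ≠ 0) (h : d * m ∣ q) : gamma0 q ≤ levelGroup d m := by
  rw [← levelGroup_one]
  exact levelGroup_mono hd (one_dvd _) (by rwa [one_mul])

end LevelGroups

section CuspForms

variable {k d m q : ℕ} {Γ Γ' : Subgroup (GL (Fin 2) ℝ)} {f g : ℍ → ℂ}

/-- `f` is a cusp form of weight `k` on `Γ`. For `Γ = gamma0 ℓ` this is membership in `A(ℓ)`. -/
def IsCuspOn (k : ℕ) (Γ : Subgroup (GL (Fin 2) ℝ)) (f : ℍ → ℂ) : Prop :=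
  ∃ F : CuspForm Γ (k : ℤ), (F : ℍ → ℂ) = f

theorem IsCuspOn.mono (hf : IsCuspOn k Γ f) (h : Γ' ≤ Γ) : IsCuspOn k Γ' f := by
  obtain ⟨F, rfl⟩ := hf
  exact ⟨{ toFun := F
           slash_action_eq' := fun g hg => F.slash_action_eq' g (h hg)
           holo' := F.holo'
           zero_at_cusps' := fun hc => F.zero_at_cusps' (hc.mono h) }, rfl⟩

theorem IsCuspOn.smul [Γ.HasDetOne] (hf : IsCuspOn k Γ f) (c : ℂ) : IsCuspOn k Γ (c • f) := by
  obtain ⟨F, rfl⟩ := hf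
  exact ⟨c • F, rfl⟩

theorem IsCuspOn.slash (hf : IsCuspOn k Γ f) (g : GL (Fin 2) ℝ) :
    IsCuspOn k (ConjAct.toConjAct g⁻¹ • Γ) (f ∣[(k : ℤ)] g) := by
  obtain ⟨F, rfl⟩ := hf
  exact ⟨CuspForm.translate F g, rfl⟩

theorem IsCuspOn.continuous (hf : IsCuspOn k Γ f) : Continuous f := by
  obtain ⟨F, rfl⟩ := hf
  exact F.holo'.continuous

theorem isCuspOn_levelGroup_iff (hd : d ≠ 0) :
    IsCuspOn k (levelGroup d m) f ↔ ∃ φ ∈ cuspSpace k m, raise k d φ = f := by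
  constructor
  · intro hf
    set c : ℂ := (((d : ℝ) ^ ((k : ℝ) / 2) : ℝ) : ℂ) / (d : ℂ) ^ ((k : ℤ) - 1) with hc
    have hc0 : c ≠ 0 := div_ne_zero (Complex.ofReal_ne_zero.2 (by positivity))
      (zpow_ne_zero _ (by exact_mod_cast hd))
    have hslash := hf.slash (affineMap d 0)⁻¹
    rw [levelGroup, smul_smul, ← map_mul, inv_inv, mul_inv_cancel, map_one, one_smul] at hslash
    refine ⟨c⁻¹ • (f ∣[(k : ℤ)] (affineMap d 0)⁻¹), hslash.smul _, ?_⟩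
    rw [raise_smul, raise_eq_smul_slash hd, ← hc, smul_smul, inv_mul_cancel₀ hc0, one_smul,
      ← SlashAction.slash_mul, inv_mul_cancel, SlashAction.slash_one]
  · rintro ⟨φ, hφ, rfl⟩
    rw [raise_eq_smul_slash hd]
    exact (IsCuspOn.slash hφ _).smul _

theorem isCuspOn_levelGroup_raise (hd : d ≠ 0) {φ : ℍ → ℂ} (hφ : φ ∈ cuspSpace k m) :
    IsCuspOn k (levelGroup d m) (raise k d φ) :=
  (isCuspOn_levelGroup_iff hd).2 ⟨φ, hφ, rfl⟩

theorem raise_mem_cuspSpace (hd : d ≠ 0) (h : d * m ∣ q) {φ : ℍ → ℂ} (hφ : φ ∈ cuspSpace k m) :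
    raise k d φ ∈ cuspSpace k q :=
  (isCuspOn_levelGroup_raise hd hφ).mono (gamma0_le_levelGroup hd h)

end CuspForms

section PeterssonMean

open ConjAct

variable {V : ℝ} {k d m q : ℕ} {Γ : Subgroup (GL (Fin 2) ℝ)} {f g : ℍ → ℂ}

theorem IsCuspOn.continuous_petersson (hf : IsCuspOn k Γ f) (hg : IsCuspOn k Γ g) :
    Continuous (petersson k f g) :=
  petersson_continuous _ hf.continuous hg.continuous

theorem IsCuspOn.integrableOn_petersson [Γ.IsArithmetic] (hf : IsCuspOn k Γ f)
    (hg : IsCuspOn k Γ g) {D : Set ℍ} (hD : volume D < ⊤) : IntegrableOn (petersson k f g) D := by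
  have hcont := hf.continuous_petersson hg
  obtain ⟨F, rfl⟩ := hf
  obtain ⟨G, rfl⟩ := hg
  obtain ⟨C, hC⟩ := CuspFormClass.petersson_bounded_left k Γ F G
  exact Measure.integrableOn_of_bounded hD.ne hcont.aestronglyMeasurable (.of_forall hC)

theorem IsCuspOn.petersson_smul [Γ.HasDetOne] (hf : IsCuspOn k Γ f) (hg : IsCuspOn k Γ g)
    {γ : GL (Fin 2) ℝ} (hγ : γ ∈ Γ) (z : ℍ) : petersson k f g (γ • z) = petersson k f g z := by
  obtain ⟨F, rfl⟩ := hf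
  obtain ⟨G, rfl⟩ := hg
  exact SlashInvariantFormClass.petersson_smul hγ

theorem hasInvariantMean_petersson [NeZero q] (hf : f ∈ cuspSpace k q) (hg : g ∈ cuspSpace k q) :
    HasInvariantMean volume (mobiusGamma0 q) (petersson k f g)
      (⨍ z in fundDomain q, petersson k f g z) := by
  refine ⟨?_, _, isFundamentalDomain_fundDomain q,
    IsCuspOn.integrableOn_petersson (Γ := gamma0 q) hf hg (volume_fundDomain_lt_top q), rfl⟩
  rintro _ ⟨γ, hγ, rfl⟩
  exact IsCuspOn.petersson_smul (Γ := gamma0 q) hf hg hγ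

theorem integrable_petersson (V : ℝ) [NeZero q] (hf : f ∈ cuspSpace k q) (hg : g ∈ cuspSpace k q) :
    Integrable (petersson k f g) (levelMeasure V q) :=
  integrable_levelMeasure_of_integrableOn V
    (IsCuspOn.integrableOn_petersson (Γ := gamma0 q) hf hg (volume_fundDomain_lt_top q))

theorem peterssonInner_raise (hV : 0 < V) [NeZero q] (h : d * m ∣ q) (hf : f ∈ cuspSpace k m)
    (hg : g ∈ cuspSpace k m) :
    peterssonInner V k q (raise k d f) (raise k d g) = peterssonInner V k m f g := by
  obtain ⟨hd, hm⟩ := mul_ne_zero_iff.1 (ne_zero_of_dvd_ne_zero (NeZero.ne q) h)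
  have : NeZero m := ⟨hm⟩
  have conj_eq : toConjAct (toMobius (affineMap d 0))⁻¹ • mobiusGamma0 m =
      (levelGroup d m).map toMobius := by
    rw [levelGroup, map_toConjAct_smul, map_inv toMobius]
  have relIndex_ne_zero : (mobiusGamma0 q).relIndex ((levelGroup d m).map toMobius) ≠ 0 :=
    relIndex_map_ne_zero _ (Subgroup.IsArithmetic.is_commensurable.trans
      Subgroup.IsArithmetic.is_commensurable.symm).1
  have hmean := (hasInvariantMean_petersson hf hg).comp_smul (toMobius (affineMap d 0))
  rw [conj_eq] at hmean
  rw [peterssonInner_eq_mul_setAverage hV, peterssonInner_eq_mul_setAverage hV,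
    ← ((hmean.of_le (Subgroup.map_mono (gamma0_le_levelGroup hd h))
      relIndex_ne_zero).integrableOn_and_setAverage_eq (isFundamentalDomain_fundDomain q)).2]
  simp only [petersson_raise hd, toMobius_smul]

end PeterssonMean

section Trace

variable {V : ℝ} {k q : ℕ} {G G₁ G₂ : Subgroup (GL (Fin 2) ℝ)} {u w : ℍ → ℂ}

theorem IsCuspOn.petersson_slash_right [G₁.HasDetOne] (hu : IsCuspOn k G₁ u) (w : ℍ → ℂ)
    {r : GL (Fin 2) ℝ} (hr : r ∈ G₁) (z : ℍ) :
    petersson k u (w ∣[(k : ℤ)] r) z = petersson k u w (r • z) := by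
  have hdet : r.det = 1 := Subgroup.HasDetOne.det_eq hr
  have hσ : σ r = .refl ℝ ℂ := by
    rw [σ, if_pos (by rw [hdet]; simp)]
  obtain ⟨U, rfl⟩ := hu
  nth_rw 1 [← SlashInvariantFormClass.slash_action_eq U r hr]
  rw [petersson_slash, hdet, hσ]
  simp

theorem exists_isCuspOn_sum_slash [G.HasDetOne] [G₂.HasDetOne] [G₂.IsFiniteRelIndex G]
    [Fintype (G ⧸ G₂.subgroupOf G)]
    (hfactor : (G : Set (GL (Fin 2) ℝ)) ⊆ (G₁ : Set (GL (Fin 2) ℝ)) * G₂) (hw : IsCuspOn k G₂ w) :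
    ∃ r : G ⧸ G₂.subgroupOf G → GL (Fin 2) ℝ,
      (∀ c, r c ∈ G₁) ∧ IsCuspOn k G (∑ c, w ∣[(k : ℤ)] r c) := by
  obtain ⟨W, rfl⟩ := hw
  have exists_slash (c : G ⧸ G₂.subgroupOf G) :
      ∃ r ∈ G₁, SlashInvariantForm.quotientFunc W c = (W : ℍ → ℂ) ∣[(k : ℤ)] r := by
    induction c using Quotient.inductionOn with
    | h g =>
      obtain ⟨g₁, hg₁, g₂, hg₂, hmul⟩ := Set.mem_mul.1 (hfactor g.2)
      refine ⟨g₁⁻¹, inv_mem hg₁, ?_⟩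
      rw [SlashInvariantForm.quotientFunc_mk, ← hmul, mul_inv_rev, SlashAction.slash_mul,
        SlashInvariantFormClass.slash_action_eq W g₂⁻¹ (inv_mem hg₂)]
  choose r hr hslash using exists_slash
  refine ⟨r, hr, CuspForm.trace G W, ?_⟩
  rw [CuspForm.coe_trace]
  convert Finset.sum_congr rfl fun c _ => hslash c

theorem petersson_smul_right (k : ℤ) (f g : ℍ → ℂ) (c : ℂ) :
    petersson k f (c • g) = c • petersson k f g := by
  ext z
  simp only [petersson, Pi.smul_apply, smul_eq_mul]
  ring

theorem peterssonInner_smul_right (V : ℝ) (k ℓ : ℕ) (f g : ℍ → ℂ) (c : ℂ) :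
    peterssonInner V k ℓ f (c • g) = c * peterssonInner V k ℓ f g := by
  rw [peterssonInner, petersson_smul_right]
  exact integral_const_mul c _

/-- The form `t` is the trace of `w` from `G₂` to `G`, divided by the index. Since `G = G₁ G₂`, this
trace is a sum of slashes of `w` by elements of `G₁`, and these do not change the inner products
with forms on `G₁`. -/
theorem exists_isCuspOn_peterssonInner_eq (hV : 0 < V) [NeZero q] [G.IsArithmetic] [G.HasDetOne]
    [G₁.IsArithmetic] [G₁.HasDetOne] [G₂.IsArithmetic] [G₂.HasDetOne] (hG : gamma0 q ≤ G)
    (hG₁ : gamma0 q ≤ G₁) (hG₂ : gamma0 q ≤ G₂)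
    (hfactor : (G : Set (GL (Fin 2) ℝ)) ⊆ (G₁ : Set (GL (Fin 2) ℝ)) * G₂) (hw : IsCuspOn k G₂ w) :
    ∃ t, IsCuspOn k G t ∧ ∀ u, IsCuspOn k G₁ u →
      peterssonInner V k q u t = peterssonInner V k q u w := by
  have : G₂.IsFiniteRelIndex G := ⟨(Subgroup.IsArithmetic.is_commensurable.trans
    Subgroup.IsArithmetic.is_commensurable.symm).1⟩
  have := Fintype.ofFinite (G ⧸ G₂.subgroupOf G)
  obtain ⟨r, hr, htrace⟩ := exists_isCuspOn_sum_slash hfactor hw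
  set t := ∑ c, w ∣[(k : ℤ)] r c with ht
  refine ⟨(Fintype.card (G ⧸ G₂.subgroupOf G) : ℂ)⁻¹ • t, htrace.smul _, fun u hu => ?_⟩
  have hmean := hasInvariantMean_petersson (hu.mono hG₁) (hw.mono hG₂)
  have hmean_trace := hasInvariantMean_petersson (hu.mono hG₁) (htrace.mono hG)
  have petersson_trace : petersson k u t = fun z => ∑ c, petersson k u w (toMobius (r c) • z) := by
    ext z
    simp_rw [toMobius_smul, ← hu.petersson_slash_right w (hr _)]
    simp only [ht, petersson, Finset.sum_apply, Finset.mul_sum, Finset.sum_mul]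
  have mem_commensurator (c) :
      toMobius (r c) ∈ Subgroup.Commensurable.commensurator (mobiusGamma0 q) :=
    mem_commensurator_of_mem_of_commensurable (Subgroup.mem_map_of_mem toMobius (hr c))
      (commensurable_map toMobius (Subgroup.IsArithmetic.is_commensurable.trans
        Subgroup.IsArithmetic.is_commensurable.symm))
  have mean_eq := hmean.eq_card_smul_of_sum_comp_smul mem_commensurator
    (by rwa [← petersson_trace])
  rw [peterssonInner_smul_right, peterssonInner_eq_mul_setAverage hV,
    peterssonInner_eq_mul_setAverage hV, mean_eq, nsmul_eq_mul, mul_left_comm,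
    inv_mul_cancel_left₀ (Nat.cast_ne_zero.2 Fintype.card_ne_zero)]

end Trace

section LevelFactorization

variable {d e m p : ℕ}

theorem exists_dvd_add_mul {R : Type*} [CommRing R] {x y : R} (h : IsCoprime x y) (b : R) :
    ∃ t, x ∣ b + y * t := by
  obtain ⟨u, v, h⟩ := h
  exact ⟨-b * v, b * u, by linear_combination -b * h⟩

theorem isCoprime_of_mul_sub_eq_one (hp : p.Prime) (hd : ¬p ∣ d) (hm : p ∣ m) {x y z : ℤ}
    (hdet : x * y - z * m = 1) : IsCoprime (p : ℤ) (x * d) := by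
  refine IsCoprime.mul_right ?_ (Nat.isCoprime_iff_coprime.2 (hp.coprime_iff_not_dvd.2 hd))
  obtain ⟨m', rfl⟩ := hm
  exact ⟨-z * m', y, by push_cast at hdet; linear_combination hdet⟩

theorem levelGroup_subset_mul_levelGroup_prime (hp : p.Prime) (hd : ¬p ∣ d) (hm : p ∣ m) (n : ℕ) :
    (levelGroup (d * p) m : Set (GL (Fin 2) ℝ)) ⊆
      (levelGroup d (p * m) : Set (GL (Fin 2) ℝ)) * levelGroup p n := by
  intro g hg
  have hd0 : d ≠ 0 := fun h => hd (by simp [h])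
  have hdr : (d : ℝ) ≠ 0 := by exact_mod_cast hd0
  have hpr : (p : ℝ) ≠ 0 := by exact_mod_cast hp.ne_zero
  obtain ⟨a, b, c, e, hdet, hg⟩ := (mem_levelGroup_iff (mul_ne_zero hd0 hp.ne_zero)).1 hg
  obtain ⟨t, b', hb'⟩ := exists_dvd_add_mul (isCoprime_of_mul_sub_eq_one (x := a) (y := e)
    (z := b * c) hp hd hm (by linear_combination hdet)) b
  have mem_translation : affineMap 1 (t / p) ∈ levelGroup p n := by
    refine (mem_levelGroup_iff hp.ne_zero).2 ⟨1, t, 0, 1, by ring, ?_⟩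
    rw [affineMap_val _ one_ne_zero]
    simp
  refine ⟨g * affineMap 1 (t / p), ?_, _, inv_mem mem_translation, by group⟩
  refine (mem_levelGroup_iff hd0).2 ⟨a, b', c, e + c * m * d * t, ?_, ?_⟩
  · push_cast
    linear_combination hdet + c * m * hb'
  · have hb'' : (b : ℝ) + a * d * t = p * b' := by exact_mod_cast hb'
    rw [Units.val_mul, hg, affineMap_val _ one_ne_zero]
    ext i j
    fin_cases i <;> fin_cases j <;> simp [Matrix.mul_apply, Fin.sum_univ_two]
    · field_simp
      linear_combination hb''
    · ring
    · field_simp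
      ring

theorem levelGroup_subset_mul_gamma0 (hp : p.Prime) (hd : d ≠ 0) (he : ¬p ∣ e) (hm : p ∣ m) :
    (levelGroup d m : Set (GL (Fin 2) ℝ)) ⊆
      (levelGroup d (p * m) : Set (GL (Fin 2) ℝ)) * gamma0 (d * e * m) := by
  intro g hg
  have hdr : (d : ℝ) ≠ 0 := by exact_mod_cast hd
  obtain ⟨a, b, c, δ, hdet, hg⟩ := (mem_levelGroup_iff hd).1 hg
  obtain ⟨s, c', hc'⟩ := exists_dvd_add_mul (isCoprime_of_mul_sub_eq_one (x := δ) (y := a)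
    (z := b * c) hp he hm (by linear_combination hdet)) c
  obtain ⟨x, hx⟩ : ∃ x : GL (Fin 2) ℝ, x.val = !![1, 0; (s : ℝ) * (d * e * m), 1] :=
    ⟨Matrix.GeneralLinearGroup.mkOfDetNeZero _ (by simp), rfl⟩
  have mem_gamma0 : x ∈ gamma0 (d * e * m) :=
    mem_gamma0_iff.2 ⟨1, 0, s, 1, by ring, by rw [hx]; simp⟩
  refine ⟨g * x, ?_, _, inv_mem mem_gamma0, by group⟩
  refine (mem_levelGroup_iff hd).2 ⟨a + b * s * e * m, b, c', δ, ?_, ?_⟩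
  · push_cast
    linear_combination hdet + b * m * hc'
  · have hc'' : (c : ℝ) + δ * e * s = p * c' := by exact_mod_cast hc'
    rw [Units.val_mul, hg, hx]
    ext i j
    fin_cases i <;> fin_cases j <;> simp [Matrix.mul_apply, Fin.sum_univ_two]
    · field_simp
    · linear_combination (m : ℝ) * d * hc''

end LevelFactorization

section Growth

open ConjAct

variable {k q : ℕ} {Γ : Subgroup (GL (Fin 2) ℝ)} {a : ℚ} {f g φ Ψ : ℍ → ℂ}

/-- The size `|f z| y ^ (k / 2)` of a form of weight `k`, which is invariant under the group of the
form. -/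
def peterssonNorm (k : ℕ) (f : ℍ → ℂ) (z : ℍ) : ℝ := ‖f z‖ * z.im ^ ((k : ℝ) / 2)

theorem peterssonNorm_nonneg (k : ℕ) (f : ℍ → ℂ) (z : ℍ) : 0 ≤ peterssonNorm k f z :=
  mul_nonneg (norm_nonneg _) (Real.rpow_nonneg z.im_pos.le _)

theorem norm_petersson (k : ℕ) (f g : ℍ → ℂ) (z : ℍ) :
    ‖petersson k f g z‖ = peterssonNorm k f z * peterssonNorm k g z := by
  have hsq : z.im ^ k = z.im ^ ((k : ℝ) / 2) * z.im ^ ((k : ℝ) / 2) := by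
    rw [← Real.rpow_add z.im_pos, add_halves, Real.rpow_natCast]
  rw [petersson, zpow_natCast, norm_mul, norm_mul, norm_pow, Complex.norm_real, Complex.norm_conj,
    Real.norm_of_nonneg z.im_pos.le, hsq, peterssonNorm, peterssonNorm]
  ring

/-- The space of continuous functions `f` on the upper half-plane with `|f z| y ^ (k / 2)` bounded.
It contains the cusp forms of weight `k` of every positive level and is stable under every Hecke
operator. -/
def boundedForms (k : ℕ) : Submodule ℂ (ℍ → ℂ) where
  carrier := {f | Continuous f ∧ ∃ C, ∀ z, peterssonNorm k f z ≤ C}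
  add_mem' := by
    rintro f g ⟨hf, C, hC⟩ ⟨hg, C', hC'⟩
    refine ⟨hf.add hg, C + C', fun z => le_trans ?_ (add_le_add (hC z) (hC' z))⟩
    rw [peterssonNorm, peterssonNorm, peterssonNorm, ← add_mul]
    exact mul_le_mul_of_nonneg_right (norm_add_le _ _) (Real.rpow_nonneg z.im_pos.le _)
  zero_mem' := ⟨continuous_const, 0, fun z => by simp [peterssonNorm]⟩
  smul_mem' := by
    rintro c f ⟨hf, C, hC⟩
    refine ⟨hf.const_smul c, ‖c‖ * C, fun z => ?_⟩
    rw [peterssonNorm, Pi.smul_apply, norm_smul, mul_assoc]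
    exact mul_le_mul_of_nonneg_left (hC z) (norm_nonneg c)

theorem cuspSpace_le_boundedForms (k q : ℕ) [NeZero q] : cuspSpace k q ≤ boundedForms k := by
  intro φ hφ
  refine ⟨IsCuspOn.continuous (Γ := gamma0 q) hφ, ?_⟩
  obtain ⟨F, rfl⟩ := hφ
  obtain ⟨C, hC⟩ := CuspFormClass.exists_bound F
  refine ⟨C, fun z => ?_⟩
  rw [peterssonNorm, ← le_div_iff₀ (Real.rpow_pos_of_pos z.im_pos _)]
  simpa only [Int.cast_natCast] using hC z

theorem comp_affineMap_mem_boundedForms (hf : f ∈ boundedForms k) (ha : 0 < a) (b : ℚ) :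
    (fun z => f (affineMap a b • z)) ∈ boundedForms k := by
  obtain ⟨hcont, C, hC⟩ := hf
  have ha' : (0 : ℝ) < a := by exact_mod_cast ha
  refine ⟨hcont.comp (continuous_const_smul _), C / (a : ℝ) ^ ((k : ℝ) / 2), fun z => ?_⟩
  rw [le_div_iff₀ (by positivity)]
  refine le_of_eq_of_le ?_ (hC (affineMap a b • z))
  rw [peterssonNorm, peterssonNorm, im_affineMap_smul _ ha, Real.mul_rpow ha'.le z.im_pos.le]
  ring

/-- The Hecke operator as a linear map. -/
def heckeHom (k n : ℕ) : (ℍ → ℂ) →ₗ[ℂ] ℍ → ℂ where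
  toFun := hecke k n
  map_add' φ ψ := by
    ext z
    simp only [hecke, Pi.add_apply, Finset.sum_add_distrib, mul_add]
  map_smul' c φ := by
    ext z
    simp only [hecke, Pi.smul_apply, smul_eq_mul, ← Finset.mul_sum, mul_left_comm _ c,
      RingHom.id_apply]

theorem hecke_eq_sum_smul (k n : ℕ) (φ : ℍ → ℂ) :
    hecke k n φ = (n : ℂ) ^ ((k : ℤ) - 1) • ∑ d ∈ n.divisors, (d : ℂ) ^ (-(k : ℤ)) •
      ∑ b ∈ Finset.range d, fun z => φ (affineMap ((n / d : ℕ) / d) (b / d) • z) := by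
  ext z
  simp only [hecke, Pi.smul_apply, Finset.sum_apply, smul_eq_mul]
  congr 1
  refine Finset.sum_congr rfl fun d hd => ?_
  have hd0 : 0 < d := Nat.pos_of_mem_divisors hd
  have hnd : 0 < n / d := Nat.div_pos (Nat.divisor_le hd) hd0
  congr 1
  refine Finset.sum_congr rfl fun b _ => ?_
  rw [← ofComplex_mul_add _ (by positivity)]
  congr 2
  push_cast
  ring

theorem hecke_mem_boundedForms (hf : f ∈ boundedForms k) (n : ℕ) :
    hecke k n f ∈ boundedForms k := by
  rw [hecke_eq_sum_smul]
  refine Submodule.smul_mem _ _ (sum_mem fun d hd => Submodule.smul_mem _ _ (sum_mem fun b _ =>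
    comp_affineMap_mem_boundedForms hf ?_ _))
  have hd0 : 0 < d := Nat.pos_of_mem_divisors hd
  have hnd : 0 < n / d := Nat.div_pos (Nat.divisor_le hd) hd0
  positivity

theorem IsCuspOn.exists_peterssonNorm_mul_rpow_le [Γ.IsArithmetic] (hf : IsCuspOn k Γ f) (A : ℝ) :
    ∃ C, ∀ z ∈ 𝒟, peterssonNorm k f z * z.im ^ A ≤ C := by
  have hcont := hf.continuous_petersson hf
  have hO : petersson k f f =O[atImInfty] fun z => z.im ^ (-(2 * A)) := by
    obtain ⟨F, rfl⟩ := hf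
    obtain ⟨c, hc, hO⟩ := (CuspFormClass.zero_at_infty F).petersson_exp_decay_left k Γ F
    exact hO.trans
      ((isLittleO_exp_neg_mul_rpow_atTop hc _).isBigO.comp_tendsto Filter.tendsto_comap)
  obtain ⟨C, hC⟩ := ModularGroup.exists_bound_fundamental_domain_of_isBigO hcont hO
  refine ⟨√C, fun z hz => Real.le_sqrt_of_sq_le ?_⟩
  have h := hC z hz
  rw [norm_petersson, Real.rpow_neg z.im_pos.le, ← div_eq_mul_inv,
    le_div_iff₀ (Real.rpow_pos_of_pos z.im_pos _), mul_comm 2 A, Real.rpow_mul z.im_pos.le,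
    Real.rpow_two] at h
  rwa [mul_pow, sq (peterssonNorm k f z)]

theorem exists_peterssonNorm_smul_mul_rpow_le [NeZero q] (hφ : φ ∈ cuspSpace k q) (γ : SL(2, ℤ))
    (A : ℝ) : ∃ C, ∀ z ∈ 𝒟, peterssonNorm k φ (γ • z) * z.im ^ A ≤ C := by
  have : (toConjAct (γ : GL (Fin 2) ℝ)⁻¹ • gamma0 q).IsArithmetic := by
    simpa [(show Rat.castHom ℝ = algebraMap ℚ ℝ by rfl), map_inv,
      Matrix.SpecialLinearGroup.map_mapGL]
      using! Subgroup.IsArithmetic.conj (gamma0 q) (Matrix.SpecialLinearGroup.mapGL ℚ γ)⁻¹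
  have norm_slash (z : ℍ) :
      peterssonNorm k (φ ∣[(k : ℤ)] (γ : GL (Fin 2) ℝ)) z = peterssonNorm k φ (γ • z) := by
    rw [← sq_eq_sq₀ (peterssonNorm_nonneg k _ z) (peterssonNorm_nonneg k _ _), sq, sq,
      ← norm_petersson, ← norm_petersson]
    exact congrArg norm (petersson_slash_SL _ _ _ _ _)
  simpa only [norm_slash] using
    (IsCuspOn.slash (Γ := gamma0 q) hφ γ).exists_peterssonNorm_mul_rpow_le A

theorem aestronglyMeasurable_petersson {μ : Measure ℍ} (k : ℤ) (hf : AEStronglyMeasurable f μ)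
    (hg : AEStronglyMeasurable g μ) : AEStronglyMeasurable (petersson k f g) μ := by
  have him : Continuous fun z : ℍ => (z.im : ℂ) ^ k :=
    (Complex.continuous_ofReal.comp continuous_im).zpow₀ k fun z =>
      .inl (Complex.ofReal_ne_zero.2 z.im_ne_zero)
  exact ((Complex.continuous_conj.comp_aestronglyMeasurable hf).mul hg).mul
    him.aestronglyMeasurable

theorem exists_norm_petersson_mul_smul_le [NeZero q] (hφ : φ ∈ cuspSpace k q)
    (hg : g ∈ boundedForms k) (hΨ : ModerateGrowth Ψ) (γ : SL(2, ℤ)) :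
    ∃ C, ∀ z ∈ 𝒟, ‖petersson k φ (Ψ * g) (γ • z)‖ ≤ C := by
  obtain ⟨CΨ, A, hCΨ⟩ := hΨ
  obtain ⟨Cφ, hCφ⟩ := exists_peterssonNorm_smul_mul_rpow_le hφ γ A
  obtain ⟨-, Cg, hCg⟩ := hg
  refine ⟨Cφ * |CΨ| * Cg, fun z hz => ?_⟩
  have hΨz : ‖Ψ (γ • z)‖ ≤ |CΨ| * z.im ^ A := (hCΨ γ z hz).trans
    (mul_le_mul_of_nonneg_right (le_abs_self _) (Real.rpow_nonneg z.im_pos.le _))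
  have hφ0 := peterssonNorm_nonneg k φ (γ • z)
  calc ‖petersson k φ (Ψ * g) (γ • z)‖
      = peterssonNorm k φ (γ • z) * ‖Ψ (γ • z)‖ * peterssonNorm k g (γ • z) := by
        rw [norm_petersson, peterssonNorm.eq_1 k (Ψ * g), Pi.mul_apply, norm_mul,
          peterssonNorm.eq_1 k g]
        ring
    _ ≤ peterssonNorm k φ (γ • z) * (|CΨ| * z.im ^ A) * Cg :=
        mul_le_mul (mul_le_mul_of_nonneg_left hΨz hφ0) (hCg _) (peterssonNorm_nonneg _ _ _)
          (mul_nonneg hφ0 ((norm_nonneg _).trans hΨz))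
    _ = peterssonNorm k φ (γ • z) * z.im ^ A * |CΨ| * Cg := by ring
    _ ≤ Cφ * |CΨ| * Cg := mul_le_mul_of_nonneg_right
        (mul_le_mul_of_nonneg_right (hCφ z hz) (abs_nonneg _))
        ((peterssonNorm_nonneg k g z).trans (hCg z))

theorem integrable_petersson_mul (V : ℝ) [NeZero q] (hφ : φ ∈ cuspSpace k q)
    (hg : g ∈ boundedForms k) (hΨm : AEMeasurable Ψ (volume : Measure ℍ)) (hΨ : ModerateGrowth Ψ) :
    Integrable (petersson k φ (Ψ * g)) (levelMeasure V q) := by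
  have : Finite (SL(2, ℤ) ⧸ CongruenceSubgroup.Gamma0 q) :=
    Subgroup.finite_quotient_of_finiteIndex
  have hmeas : AEStronglyMeasurable (petersson k φ (Ψ * g)) volume :=
    aestronglyMeasurable_petersson k
      (IsCuspOn.continuous (Γ := gamma0 q) hφ).aestronglyMeasurable
      (hΨm.aestronglyMeasurable.mul hg.1.aestronglyMeasurable)
  refine integrable_levelMeasure_of_integrableOn V (integrableOn_finite_iUnion.2 fun c => ?_)
  set γ := (Quotient.out c)⁻¹
  obtain ⟨C, hC⟩ := exists_norm_petersson_mul_smul_le hφ hg hΨ γ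
  refine (integrableOn_smul_set_iff
    (toMobius (Matrix.SpecialLinearGroup.mapGL ℝ γ)) 𝒟 _).2 ?_
  exact Measure.integrableOn_of_bounded volume_fd_lt_top.ne
    (hmeas.comp_measurePreserving (measurePreserving_smul _ volume))
    ((ae_restrict_iff' ModularGroup.isClosed_fd.measurableSet).2 (.of_forall hC))

end Growth

section FrameOperator

variable {X ι κ : Type*} [AddCommGroup X] [Module ℂ X] {H : X →ₗ⋆[ℂ] X →ₗ[ℂ] ℂ}

/-- The frame operator `x ↦ ∑ H (w j) x • w j` of a finite family of vectors. For a family that is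
orthonormal for `H` it is the orthogonal projection to its span. -/
def frameOperator (H : X →ₗ⋆[ℂ] X →ₗ[ℂ] ℂ) (s : Finset ι) (w : ι → X) : X →ₗ[ℂ] X :=
  ∑ j ∈ s, (H (w j)).smulRight (w j)

theorem frameOperator_apply (s : Finset ι) (w : ι → X) (x : X) :
    frameOperator H s w x = ∑ j ∈ s, H (w j) x • w j := by
  simp [frameOperator]

theorem frameOperator_symm (hH : ∀ x y, starRingEnd ℂ (H x y) = H y x) (s : Finset ι) (w : ι → X)
    (x y : X) : H (frameOperator H s w x) y = H x (frameOperator H s w y) := by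
  simp only [frameOperator_apply, map_sum, LinearMap.sum_apply, map_smul, map_smulₛₗ,
    LinearMap.smul_apply, smul_eq_mul, hH]
  exact Finset.sum_congr rfl fun j _ => mul_comm _ _

theorem frameOperator_apply_of_mem_span {s : Finset ι} {v : ι → X}
    (hnorm : ∀ i ∈ s, H (v i) (v i) = 1) (horth : ∀ i ∈ s, ∀ j ∈ s, i ≠ j → H (v i) (v j) = 0)
    {x : X} (hx : x ∈ Submodule.span ℂ (v '' s)) : frameOperator H s v x = x := by
  refine LinearMap.eqOn_span (g := LinearMap.id) ?_ hx
  rintro _ ⟨i, hi, rfl⟩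
  rw [frameOperator_apply, Finset.sum_eq_single_of_mem i hi fun j hj hne => by
    rw [horth j hj i hi hne, zero_smul], hnorm i hi, one_smul, LinearMap.id_apply]

/-- The functional `T ↦ ∑ S (v i) (T (v i))` on linear operators: the trace of the sesquilinear
form `S (·) (T ·)` in the family `v`. -/
def diagonalSum (S : X →ₗ⋆[ℂ] X →ₗ[ℂ] ℂ) (s : Finset ι) (v : ι → X) : (X →ₗ[ℂ] X) →ₗ[ℂ] ℂ :=
  ∑ i ∈ s, S (v i) ∘ₗ LinearMap.applyₗ (v i)

theorem diagonalSum_frameOperator (hH : ∀ x y, starRingEnd ℂ (H x y) = H y x)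
    (S : X →ₗ⋆[ℂ] X →ₗ[ℂ] ℂ) {s : Finset ι} {v : ι → X} (hv : frameOperator H s v = LinearMap.id)
    (t : Finset κ) (w : κ → X) :
    diagonalSum S s v (frameOperator H t w) = ∑ j ∈ t, S (w j) (w j) := by
  have expand (j : κ) : S (w j) (w j) = ∑ i ∈ s, H (w j) (v i) * S (v i) (w j) := by
    calc S (w j) (w j) = S (frameOperator H s v (w j)) (w j) := by rw [hv, LinearMap.id_apply]
      _ = _ := by
        simp only [frameOperator_apply, map_sum, LinearMap.sum_apply, map_smulₛₗ,
          LinearMap.smul_apply, smul_eq_mul, hH]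
  simp only [diagonalSum, LinearMap.sum_apply, LinearMap.comp_apply, LinearMap.applyₗ_apply_apply,
    frameOperator_apply, map_sum, map_smul, smul_eq_mul, expand]
  exact Finset.sum_comm

end FrameOperator

section Forms

variable {k q : ℕ} {V : ℝ}

/-- The sesquilinear form `(f, g) ↦ ⟨f, L g⟩` on cusp forms. -/
def innerForm (V : ℝ) (k q : ℕ) (L : cuspSpace k q →ₗ[ℂ] ℍ → ℂ)
    (hL : ∀ f g : cuspSpace k q, Integrable (petersson k f (L g)) (levelMeasure V q)) :
    cuspSpace k q →ₗ⋆[ℂ] cuspSpace k q →ₗ[ℂ] ℂ :=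
  LinearMap.mk₂'ₛₗ (starRingEnd ℂ) (RingHom.id ℂ) (fun f g => peterssonInner V k q f (L g))
    (fun f₁ f₂ g => by
      rw [peterssonInner, peterssonInner, peterssonInner, ← integral_add (hL f₁ g) (hL f₂ g)]
      congr 1 with z
      simp only [petersson, Submodule.coe_add, Pi.add_apply, map_add, add_mul])
    (fun c f g => by
      rw [peterssonInner, peterssonInner, smul_eq_mul, ← integral_const_mul]
      congr 1 with z
      simp only [petersson, Submodule.coe_smul, Pi.smul_apply, smul_eq_mul, map_mul, mul_assoc])
    (fun f g₁ g₂ => by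
      rw [peterssonInner, peterssonInner, peterssonInner, ← integral_add (hL f g₁) (hL f g₂)]
      congr 1 with z
      simp only [petersson, map_add, Pi.add_apply, mul_add, add_mul])
    (fun c f g => by
      rw [map_smul, peterssonInner_smul_right, RingHom.id_apply, smul_eq_mul])

/-- The Petersson inner product of level `q` as a sesquilinear form on the cusp forms. -/
def cuspInner (V : ℝ) (k q : ℕ) [NeZero q] : cuspSpace k q →ₗ⋆[ℂ] cuspSpace k q →ₗ[ℂ] ℂ :=
  innerForm V k q (cuspSpace k q).subtype fun f g => integrable_petersson V f.2 g.2

theorem cuspInner_apply [NeZero q] (f g : cuspSpace k q) :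
    cuspInner V k q f g = peterssonInner V k q f g := rfl

theorem cuspInner_conj [NeZero q] (f g : cuspSpace k q) :
    starRingEnd ℂ (cuspInner V k q f g) = cuspInner V k q g f := by
  rw [cuspInner_apply, cuspInner_apply, peterssonInner, peterssonInner, ← integral_conj]
  simp only [← petersson_symm]

open Classical in
/-- A function as an element of the space of cusp forms of level `q`, with value `0` on the
functions that are not cusp forms. It makes a family of cusp forms indexed by functions total. -/
def toCuspSpace (k q : ℕ) (f : ℍ → ℂ) : cuspSpace k q :=
  if h : f ∈ cuspSpace k q then ⟨f, h⟩ else 0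

theorem toCuspSpace_of_mem {f : ℍ → ℂ} (hf : f ∈ cuspSpace k q) : toCuspSpace k q f = ⟨f, hf⟩ :=
  dif_pos hf

theorem coe_toCuspSpace {f : ℍ → ℂ} (hf : f ∈ cuspSpace k q) : (toCuspSpace k q f : ℍ → ℂ) = f := by
  rw [toCuspSpace_of_mem hf]

theorem IsOrthonormalBasis.mem {W : Set (ℍ → ℂ)} {B : Finset (ℍ → ℂ)}
    (hB : IsOrthonormalBasis V k q W B) {φ : ℍ → ℂ} (hφ : φ ∈ B) : φ ∈ W :=
  hB.span_eq ▸ Submodule.subset_span hφ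

theorem IsOrthonormalBasis.frameOperator_apply [NeZero q] {W : Set (ℍ → ℂ)} {B : Finset (ℍ → ℂ)}
    (hB : IsOrthonormalBasis V k q W B) (hW : W ⊆ cuspSpace k q) {f : cuspSpace k q}
    (hf : (f : ℍ → ℂ) ∈ W) : frameOperator (cuspInner V k q) B (toCuspSpace k q) f = f := by
  have coe_eq {φ : ℍ → ℂ} (hφ : φ ∈ B) : (toCuspSpace k q φ : ℍ → ℂ) = φ :=
    coe_toCuspSpace (hW (hB.mem hφ))
  have map_span_eq : (Submodule.span ℂ (toCuspSpace k q '' B)).map (cuspSpace k q).subtype =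
      Submodule.span ℂ (B : Set (ℍ → ℂ)) := by
    rw [Submodule.map_span, Set.image_image]
    exact congrArg _ ((Set.image_congr fun φ hφ => coe_eq hφ).trans (Set.image_id _))
  refine frameOperator_apply_of_mem_span (fun φ hφ => ?_) (fun φ hφ ψ hψ hne => ?_) ?_
  · rw [cuspInner_apply, coe_eq hφ, hB.norm_one φ hφ]
  · rw [cuspInner_apply, coe_eq hφ, coe_eq hψ, hB.orthogonal φ hφ ψ hψ hne]
  · rw [← hB.span_eq, SetLike.mem_coe, ← map_span_eq] at hf
    obtain ⟨g, hg, hgf⟩ := hf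
    exact Subtype.ext hgf ▸ hg

theorem IsOrthonormalBasis.sum_peterssonInner_smul [NeZero q] {W : Set (ℍ → ℂ)}
    {B : Finset (ℍ → ℂ)} (hB : IsOrthonormalBasis V k q W B) (hW : W ⊆ cuspSpace k q) {f : ℍ → ℂ}
    (hf : f ∈ W) : ∑ φ ∈ B, peterssonInner V k q φ f • φ = f := by
  have h := congrArg Subtype.val (hB.frameOperator_apply hW (f := ⟨f, hW hf⟩) hf)
  rw [NewformIsolation.frameOperator_apply, AddSubmonoidClass.coe_finsetSum] at h
  refine (Finset.sum_congr rfl fun φ hφ => ?_).trans h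
  rw [Submodule.coe_smul, cuspInner_apply, coe_toCuspSpace (hW (hB.mem hφ))]

end Forms

section Arithmetic

open ArithmeticFunction (moebius)

variable {q p : ℕ}

theorem sum_squarefree_divisors_dvd {M : Type*} [AddCommMonoid M] (hp : p.Prime) (hpq : p ∣ q)
    (f : ℕ → M) : ∑ d ∈ q.divisors with Squarefree d ∧ p ∣ d, f d =
      ∑ d ∈ q.divisors with Squarefree d ∧ ¬p ∣ d, f (d * p) := by
  symm
  refine Finset.sum_bij (fun d _ => d * p) ?_ ?_ ?_ fun _ _ => rfl
  · intro d hd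
    simp only [Finset.mem_filter, Nat.mem_divisors] at hd ⊢
    obtain ⟨⟨hdq, hq⟩, hsq, hpd⟩ := hd
    have hcop : d.Coprime p := ((Nat.Prime.coprime_iff_not_dvd hp).2 hpd).symm
    exact ⟨⟨hcop.mul_dvd_of_dvd_of_dvd hdq hpq, hq⟩,
      (Nat.squarefree_mul hcop).2 ⟨hsq, hp.prime.squarefree⟩, dvd_mul_left p d⟩
  · exact fun _ _ _ _ h => Nat.eq_of_mul_eq_mul_right hp.pos h
  · intro d hd
    simp only [Finset.mem_filter, Nat.mem_divisors] at hd
    obtain ⟨⟨hdq, hq⟩, hsq, d, rfl⟩ := hd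
    refine ⟨d, ?_, mul_comm d p⟩
    simp only [Finset.mem_filter, Nat.mem_divisors]
    exact ⟨⟨dvd_of_mul_left_dvd hdq, hq⟩, hsq.of_mul_right, fun hpd =>
      hp.prime.not_isUnit (hsq p (mul_dvd_mul_left p hpd))⟩

theorem sum_moebius_smul_eq_zero {X : Type*} [AddCommGroup X] [Module ℂ X] (hp : p.Prime)
    (hpq : p ∣ q) {a : ℕ → X} (ha : ∀ d, d ∣ q → Squarefree d → ¬p ∣ d → a (d * p) = a d) :
    ∑ d ∈ q.divisors, (moebius d : ℂ) • a d = 0 := by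
  have squarefree_of_ne : ∀ d ∈ q.divisors, (moebius d : ℂ) • a d ≠ 0 → Squarefree d := by
    intro d _ h
    rw [← ArithmeticFunction.moebius_ne_zero_iff_squarefree]
    exact fun h0 => h (by rw [h0, Int.cast_zero, zero_smul])
  rw [← Finset.sum_filter_of_ne squarefree_of_ne, ← Finset.sum_filter_add_sum_filter_not _ (p ∣ ·),
    Finset.filter_filter, Finset.filter_filter, sum_squarefree_divisors_dvd hp hpq,
    ← Finset.sum_add_distrib]
  refine Finset.sum_eq_zero fun d hd => ?_
  obtain ⟨hdq, hsq, hpd⟩ := Finset.mem_filter.1 hd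
  rw [ArithmeticFunction.isMultiplicative_moebius.map_mul_of_coprime
    ((Nat.Prime.coprime_iff_not_dvd hp).2 hpd).symm, ArithmeticFunction.moebius_apply_prime hp,
    ha d (Nat.dvd_of_mem_divisors hdq) hsq hpd, mul_neg_one, Int.cast_neg, _root_.neg_smul,
    neg_add_cancel]

theorem moebius_smul_congr {X : Type*} [AddCommGroup X] [Module ℂ X] {d : ℕ} {x y : X}
    (h : Squarefree d → x = y) : (moebius d : ℂ) • x = (moebius d : ℂ) • y := by
  by_cases hd : Squarefree d
  · rw [h hd]
  · rw [ArithmeticFunction.moebius_eq_zero_of_not_squarefree hd, Int.cast_zero, zero_smul,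
      zero_smul]

theorem moebius_smul_eq_zero {X : Type*} [AddCommGroup X] [Module ℂ X] {d : ℕ} {x : X}
    (h : Squarefree d → x = 0) : (moebius d : ℂ) • x = 0 :=
  (moebius_smul_congr h).trans (smul_zero _)

theorem mul_mul_dvd_of_squarefree (hcube : ∀ p : ℕ, p.Prime → p ∣ q → p ^ 3 ∣ q) {x y z : ℕ}
    (hx : Squarefree x) (hy : Squarefree y) (hz : Squarefree z) (hxq : x ∣ q) (hyq : y ∣ q)
    (hzq : z ∣ q) : x * y * z ∣ q := by
  rcases eq_or_ne q 0 with rfl | hq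
  · exact dvd_zero _
  have hxy := mul_ne_zero hx.ne_zero hy.ne_zero
  rw [← Nat.factorization_prime_le_iff_dvd (mul_ne_zero hxy hz.ne_zero) hq]
  intro r hr
  rw [Nat.factorization_mul hxy hz.ne_zero, Nat.factorization_mul hx.ne_zero hy.ne_zero,
    Finsupp.add_apply, Finsupp.add_apply]
  by_cases hrq : r ∣ q
  · calc x.factorization r + y.factorization r + z.factorization r
        ≤ 1 + 1 + 1 := add_le_add (add_le_add (hx.natFactorization_le_one r)
          (hy.natFactorization_le_one r)) (hz.natFactorization_le_one r)
      _ ≤ q.factorization r := (hr.pow_dvd_iff_le_factorization hq).1 (hcube r hr hrq)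
  · rw [Nat.factorization_eq_zero_of_not_dvd fun h => hrq (h.trans hxq),
      Nat.factorization_eq_zero_of_not_dvd fun h => hrq (h.trans hyq),
      Nat.factorization_eq_zero_of_not_dvd fun h => hrq (h.trans hzq)]
    exact Nat.zero_le _

theorem mul_dvd_of_squarefree (hcube : ∀ p : ℕ, p.Prime → p ∣ q → p ^ 3 ∣ q) {x y : ℕ}
    (hx : Squarefree x) (hy : Squarefree y) (hxq : x ∣ q) (hyq : y ∣ q) : x * y ∣ q := by
  simpa using mul_mul_dvd_of_squarefree hcube hx hy squarefree_one hxq hyq (one_dvd q)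

end Arithmetic

section Isolation

open ArithmeticFunction (moebius)

variable {k q d e m p : ℕ} {V : ℝ} [NeZero q]

section RaisedProjection

variable {B : Finset (ℍ → ℂ)}

/-- The frame operator of the cusp forms `φ|_d`, for `φ` in `B`. If `B` is an orthonormal basis of
`A(m)` and `d m` divides `q`, it is the orthogonal projection of `A(q)` to the space of cusp forms
on `levelGroup d m`. -/
def raisedProjection (V : ℝ) (k q : ℕ) [NeZero q] (d : ℕ) (B : Finset (ℍ → ℂ)) :
    cuspSpace k q →ₗ[ℂ] cuspSpace k q :=
  frameOperator (cuspInner V k q) B fun φ => toCuspSpace k q (raise k d φ)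

theorem coe_raisedProjection (h : d * m ∣ q) (hB : IsOrthonormalBasis V k m (cuspSpace k m) B)
    (x : cuspSpace k q) : (raisedProjection V k q d B x : ℍ → ℂ) =
      ∑ φ ∈ B, peterssonInner V k q (raise k d φ) x • raise k d φ := by
  have hd := (mul_ne_zero_iff.1 (ne_zero_of_dvd_ne_zero (NeZero.ne q) h)).1
  rw [raisedProjection, frameOperator_apply, AddSubmonoidClass.coe_finsetSum]
  refine Finset.sum_congr rfl fun φ hφ => ?_
  rw [Submodule.coe_smul, cuspInner_apply, coe_toCuspSpace (raise_mem_cuspSpace hd h (hB.mem hφ))]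

theorem raisedProjection_apply_of_isCuspOn (hV : 0 < V) (h : d * m ∣ q)
    (hB : IsOrthonormalBasis V k m (cuspSpace k m) B) {x : cuspSpace k q}
    (hx : IsCuspOn k (levelGroup d m) x) : raisedProjection V k q d B x = x := by
  obtain ⟨hd, hm⟩ := mul_ne_zero_iff.1 (ne_zero_of_dvd_ne_zero (NeZero.ne q) h)
  have : NeZero m := ⟨hm⟩
  obtain ⟨ψ, hψ, hψx⟩ := (isCuspOn_levelGroup_iff hd).1 hx
  ext1
  calc (raisedProjection V k q d B x : ℍ → ℂ)
      = ∑ φ ∈ B, peterssonInner V k m φ ψ • raise k d φ := by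
        rw [coe_raisedProjection h hB, ← hψx]
        exact Finset.sum_congr rfl fun φ hφ => by rw [peterssonInner_raise hV h (hB.mem hφ) hψ]
    _ = raiseHom k d (∑ φ ∈ B, peterssonInner V k m φ ψ • φ) := by
        simp only [map_sum, map_smul]
        rfl
    _ = x := by
        rw [hB.sum_peterssonInner_smul subset_rfl hψ]
        exact hψx

theorem raisedProjection_eq_of_forall_peterssonInner_eq (hV : 0 < V) (h : d * m ∣ q)
    (hB : IsOrthonormalBasis V k m (cuspSpace k m) B) {w t : cuspSpace k q}
    (ht : IsCuspOn k (levelGroup d m) t)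
    (htw : ∀ u, IsCuspOn k (levelGroup d m) u →
      peterssonInner V k q u t = peterssonInner V k q u w) :
    raisedProjection V k q d B w = t := by
  have hd := (mul_ne_zero_iff.1 (ne_zero_of_dvd_ne_zero (NeZero.ne q) h)).1
  rw [← raisedProjection_apply_of_isCuspOn hV h hB ht]
  ext1
  rw [coe_raisedProjection h hB, coe_raisedProjection h hB]
  exact Finset.sum_congr rfl fun φ hφ => by rw [htw _ (isCuspOn_levelGroup_raise hd (hB.mem hφ))]

/-- Both projections are the normalized trace of `w` from `G₂` to `levelGroup d' m'`. -/
theorem raisedProjection_eq_of_subset_mul (hV : 0 < V) {d' m' : ℕ} (h : d * m ∣ q)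
    (h' : d' * m' ∣ q) (hle : levelGroup d m ≤ levelGroup d' m') {G₂ : Subgroup (GL (Fin 2) ℝ)}
    [G₂.IsArithmetic] [G₂.HasDetOne] (hG₂ : gamma0 q ≤ G₂)
    (hfactor : (levelGroup d' m' : Set (GL (Fin 2) ℝ)) ⊆
      (levelGroup d m : Set (GL (Fin 2) ℝ)) * G₂) {B' : Finset (ℍ → ℂ)}
    (hB : IsOrthonormalBasis V k m (cuspSpace k m) B)
    (hB' : IsOrthonormalBasis V k m' (cuspSpace k m') B') {w : cuspSpace k q}
    (hw : IsCuspOn k G₂ w) : raisedProjection V k q d' B' w = raisedProjection V k q d B w := by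
  obtain ⟨hd, hm⟩ := mul_ne_zero_iff.1 (ne_zero_of_dvd_ne_zero (NeZero.ne q) h)
  obtain ⟨hd', hm'⟩ := mul_ne_zero_iff.1 (ne_zero_of_dvd_ne_zero (NeZero.ne q) h')
  have : NeZero m := ⟨hm⟩
  have : NeZero m' := ⟨hm'⟩
  have hq := gamma0_le_levelGroup hd' h'
  obtain ⟨t, ht, htw⟩ :=
    exists_isCuspOn_peterssonInner_eq hV hq (gamma0_le_levelGroup hd h) hG₂ hfactor hw
  rw [raisedProjection_eq_of_forall_peterssonInner_eq hV h hB (t := ⟨t, ht.mono hq⟩) (ht.mono hle)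
      htw, raisedProjection_eq_of_forall_peterssonInner_eq hV h' hB' (t := ⟨t, ht.mono hq⟩) ht
      fun u hu => htw u (hu.mono hle)]

theorem raisedProjection_eq_zero_of_mem_newspace (h : d * m ∣ q) (hm : m ≠ q)
    (hB : IsOrthonormalBasis V k m (cuspSpace k m) B) {x : cuspSpace k q}
    (hx : (x : ℍ → ℂ) ∈ newspace V k q) : raisedProjection V k q d B x = 0 := by
  ext1
  rw [coe_raisedProjection h hB, ZeroMemClass.coe_zero]
  refine Finset.sum_eq_zero fun φ hφ => ?_
  rw [hx.2, zero_smul]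
  exact Submodule.subset_span ⟨m, d, dvd_of_mul_left_dvd h, hm,
    (Nat.dvd_div_iff_mul_dvd (dvd_of_mul_left_dvd h)).2 (mul_comm d m ▸ h), φ, hB.mem hφ, rfl⟩

end RaisedProjection

section Isolator

variable {B : ℕ → Finset (ℍ → ℂ)}

/-- The alternating sum of the projections to the spaces `A(q / (d e))|_d`, where `B` chooses
orthonormal bases of the spaces `A(ℓ)`. -/
def isolator (V : ℝ) (k q : ℕ) [NeZero q] (B : ℕ → Finset (ℍ → ℂ)) :
    cuspSpace k q →ₗ[ℂ] cuspSpace k q :=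
  ∑ d ∈ q.divisors, (moebius d : ℂ) • ∑ e ∈ q.divisors, (moebius e : ℂ) •
    raisedProjection V k q d (B (q / (d * e)))

theorem isolator_apply (B : ℕ → Finset (ℍ → ℂ)) (x : cuspSpace k q) :
    isolator V k q B x = ∑ d ∈ q.divisors, (moebius d : ℂ) • ∑ e ∈ q.divisors, (moebius e : ℂ) •
      raisedProjection V k q d (B (q / (d * e))) x := by
  simp only [isolator, LinearMap.sum_apply, LinearMap.smul_apply]

theorem isolator_symm (B : ℕ → Finset (ℍ → ℂ)) (x y : cuspSpace k q) :
    cuspInner V k q (isolator V k q B x) y = cuspInner V k q x (isolator V k q B y) := by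
  simp only [isolator_apply, map_sum, map_smul, map_smulₛₗ, LinearMap.sum_apply,
    LinearMap.smul_apply, raisedProjection, frameOperator_symm cuspInner_conj, map_intCast]

theorem exists_prime_isCuspOn_raise {ℓ : ℕ} (hℓ : ℓ ∣ q) (hne : ℓ ≠ q) (hd : d ∣ q / ℓ)
    {φ : ℍ → ℂ} (hφ : φ ∈ cuspSpace k ℓ) : ∃ p, p.Prime ∧ p ∣ q ∧
      (IsCuspOn k (levelGroup p (q / p)) (raise k d φ) ∨
        IsCuspOn k (gamma0 (q / p)) (raise k d φ)) := by
  obtain ⟨s, hs⟩ := (Nat.dvd_div_iff_mul_dvd hℓ).1 hd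
  have hd0 : d ≠ 0 := fun h => NeZero.ne q (by rw [hs, h, mul_zero, zero_mul])
  rcases eq_or_ne d 1 with rfl | hd1
  · have hs1 : s ≠ 1 := fun h => hne (by rw [hs, h, mul_one, mul_one])
    obtain ⟨p, hp, t, rfl⟩ := Nat.exists_prime_and_dvd hs1
    have level_eq : q / p = ℓ * t := Nat.div_eq_of_eq_mul_right hp.pos (by rw [hs]; ring)
    refine ⟨p, hp, ⟨ℓ * t, by rw [hs]; ring⟩, .inr ?_⟩
    rw [level_eq]
    exact raise_mem_cuspSpace one_ne_zero (Dvd.intro t (by ring)) hφ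
  · obtain ⟨p, hp, c, rfl⟩ := Nat.exists_prime_and_dvd hd1
    have hc : c ≠ 0 := right_ne_zero_of_mul hd0
    have level_eq : q / p = ℓ * c * s := Nat.div_eq_of_eq_mul_right hp.pos (by rw [hs]; ring)
    refine ⟨p, hp, ⟨ℓ * c * s, by rw [hs]; ring⟩, .inl ?_⟩
    rw [level_eq, ← raise_raise hp.ne_zero hc]
    exact isCuspOn_levelGroup_raise hp.ne_zero
      (raise_mem_cuspSpace hc (Dvd.intro s (by ring)) hφ)

variable (hcube : ∀ p : ℕ, p.Prime → p ∣ q → p ^ 3 ∣ q)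
  (hB : ∀ ℓ, ℓ ∣ q → IsOrthonormalBasis V k ℓ (cuspSpace k ℓ) (B ℓ))

include hB

theorem raisedProjection_mul_prime_left (hV : 0 < V) (hp : p.Prime) (hpd : ¬p ∣ d)
    (h : d * p * e * p ∣ q) {w : cuspSpace k q} (hw : IsCuspOn k (levelGroup p (q / p)) w) :
    raisedProjection V k q (d * p) (B (q / (d * p * e))) w =
      raisedProjection V k q d (B (q / (d * e))) w := by
  have hpq : p ∣ q := dvd_of_mul_left_dvd h
  obtain ⟨m, hm⟩ := h
  have : NeZero (q / p) := ⟨(Nat.div_pos (Nat.le_of_dvd (NeZero.pos q) hpq) hp.pos).ne'⟩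
  have hdpe : d * p * e ≠ 0 := fun h0 => NeZero.ne q (by rw [hm, h0, zero_mul, zero_mul])
  obtain ⟨hdp, he⟩ := mul_ne_zero_iff.1 hdpe
  have hd := left_ne_zero_of_mul hdp
  have upper_eq : q / (d * p * e) = p * m :=
    Nat.div_eq_of_eq_mul_right (Nat.pos_of_ne_zero hdpe) (by rw [hm]; ring)
  have lower_eq : q / (d * e) = p * (p * m) :=
    Nat.div_eq_of_eq_mul_right (Nat.pos_of_ne_zero (mul_ne_zero hd he)) (by rw [hm]; ring)
  rw [upper_eq, lower_eq]
  exact raisedProjection_eq_of_subset_mul hV ⟨e, by rw [hm]; ring⟩ ⟨e, by rw [hm]; ring⟩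
    (levelGroup_mono hdp (dvd_mul_right d p) (Dvd.intro 1 (by ring)))
    (gamma0_le_levelGroup hp.ne_zero (Nat.mul_div_cancel' hpq).dvd)
    (levelGroup_subset_mul_levelGroup_prime hp hpd (dvd_mul_right p m) (q / p))
    (hB _ ⟨d * e, by rw [hm]; ring⟩) (hB _ ⟨d * e * p, by rw [hm]; ring⟩) hw

theorem raisedProjection_mul_prime_right (hV : 0 < V) (hp : p.Prime) (hpe : ¬p ∣ e)
    (h : d * (e * p) * p ∣ q) {w : cuspSpace k q} (hw : IsCuspOn k (gamma0 (q / p)) w) :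
    raisedProjection V k q d (B (q / (d * (e * p)))) w =
      raisedProjection V k q d (B (q / (d * e))) w := by
  obtain ⟨m, hm⟩ := h
  have hdep : d * (e * p) ≠ 0 := fun h0 => NeZero.ne q (by rw [hm, h0, zero_mul, zero_mul])
  obtain ⟨hd, hep⟩ := mul_ne_zero_iff.1 hdep
  have upper_eq : q / (d * (e * p)) = p * m :=
    Nat.div_eq_of_eq_mul_right (Nat.pos_of_ne_zero hdep) (by rw [hm]; ring)
  have lower_eq : q / (d * e) = p * (p * m) :=
    Nat.div_eq_of_eq_mul_right (Nat.pos_of_ne_zero (mul_ne_zero hd (left_ne_zero_of_mul hep)))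
      (by rw [hm]; ring)
  have level_eq : q / p = d * e * (p * m) := Nat.div_eq_of_eq_mul_right hp.pos (by rw [hm]; ring)
  have hlevel : d * e * (p * m) ∣ q := ⟨p, by rw [hm]; ring⟩
  have : NeZero (d * e * (p * m)) := ⟨ne_zero_of_dvd_ne_zero (NeZero.ne q) hlevel⟩
  rw [upper_eq, lower_eq]
  rw [level_eq] at hw
  exact raisedProjection_eq_of_subset_mul hV ⟨e, by rw [hm]; ring⟩ ⟨e * p, by rw [hm]; ring⟩
    (levelGroup_mono hd dvd_rfl (Dvd.intro p (by ring)))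
    (levelGroup_one (d * e * (p * m)) ▸ gamma0_le_levelGroup one_ne_zero (by rwa [one_mul]))
    (levelGroup_subset_mul_gamma0 hp hd hpe (dvd_mul_right p m))
    (hB _ ⟨d * e, by rw [hm]; ring⟩) (hB _ ⟨d * e * p, by rw [hm]; ring⟩) hw

include hcube

theorem isolator_eq_zero_of_isCuspOn_levelGroup (hV : 0 < V) (hp : p.Prime) (hpq : p ∣ q)
    {w : cuspSpace k q} (hw : IsCuspOn k (levelGroup p (q / p)) w) : isolator V k q B w = 0 := by
  rw [isolator_apply]
  refine sum_moebius_smul_eq_zero hp hpq fun d hdq hd hpd => Finset.sum_congr rfl fun e he =>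
    moebius_smul_congr fun hes => raisedProjection_mul_prime_left hB hV hp hpd ?_ hw
  have hcop : d.Coprime p := ((Nat.Prime.coprime_iff_not_dvd hp).2 hpd).symm
  exact mul_mul_dvd_of_squarefree hcube ((Nat.squarefree_mul hcop).2 ⟨hd, hp.prime.squarefree⟩)
    hes hp.prime.squarefree (hcop.mul_dvd_of_dvd_of_dvd hdq hpq) (Nat.dvd_of_mem_divisors he) hpq

theorem isolator_eq_zero_of_isCuspOn_gamma0 (hV : 0 < V) (hp : p.Prime) (hpq : p ∣ q)
    {w : cuspSpace k q} (hw : IsCuspOn k (gamma0 (q / p)) w) : isolator V k q B w = 0 := by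
  rw [isolator_apply]
  refine Finset.sum_eq_zero fun d hd => moebius_smul_eq_zero fun hds =>
    sum_moebius_smul_eq_zero hp hpq fun e heq he hpe => ?_
  refine raisedProjection_mul_prime_right hB hV hp hpe ?_ hw
  have hcop : e.Coprime p := ((Nat.Prime.coprime_iff_not_dvd hp).2 hpe).symm
  exact mul_mul_dvd_of_squarefree hcube hds
    ((Nat.squarefree_mul hcop).2 ⟨he, hp.prime.squarefree⟩) hp.prime.squarefree
    (Nat.dvd_of_mem_divisors hd) (hcop.mul_dvd_of_dvd_of_dvd heq hpq) hpq

theorem oldspace_le_ker_isolator (hV : 0 < V) :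
    oldspace k q ≤ (LinearMap.ker (isolator V k q B)).map (cuspSpace k q).subtype := by
  refine Submodule.span_le.2 ?_
  rintro _ ⟨ℓ, d, hℓ, hne, hd, φ, hφ, rfl⟩
  have hdq : d * ℓ ∣ q := mul_comm ℓ d ▸ (Nat.dvd_div_iff_mul_dvd hℓ).1 hd
  have hd0 := (mul_ne_zero_iff.1 (ne_zero_of_dvd_ne_zero (NeZero.ne q) hdq)).1
  refine ⟨⟨raise k d φ, raise_mem_cuspSpace hd0 hdq hφ⟩, ?_, rfl⟩
  obtain ⟨p, hp, hpq, hw | hw⟩ := exists_prime_isCuspOn_raise hℓ hne hd hφ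
  · exact isolator_eq_zero_of_isCuspOn_levelGroup hcube hB hV hp hpq hw
  · exact isolator_eq_zero_of_isCuspOn_gamma0 hcube hB hV hp hpq hw

theorem isolator_mem_newspace (hV : 0 < V) (x : cuspSpace k q) :
    (isolator V k q B x : ℍ → ℂ) ∈ newspace V k q := by
  refine ⟨(isolator V k q B x).2, fun g hg => ?_⟩
  obtain ⟨g, hker, rfl⟩ := oldspace_le_ker_isolator hcube hB hV hg
  calc cuspInner V k q g (isolator V k q B x) = cuspInner V k q (isolator V k q B g) x :=
        (isolator_symm B g x).symm
    _ = 0 := by rw [LinearMap.mem_ker.1 hker, map_zero, LinearMap.zero_apply]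

theorem isolator_apply_of_mem_newspace (hV : 0 < V) {x : cuspSpace k q}
    (hx : (x : ℍ → ℂ) ∈ newspace V k q) : isolator V k q B x = x := by
  have vanish {d e : ℕ} (hd : d ∈ q.divisors) (he : e ∈ q.divisors) (hds : Squarefree d)
      (hes : Squarefree e) (hne : d * e ≠ 1) :
      raisedProjection V k q d (B (q / (d * e))) x = 0 := by
    have hde := mul_dvd_of_squarefree hcube hds hes (Nat.dvd_of_mem_divisors hd)
      (Nat.dvd_of_mem_divisors he)
    refine raisedProjection_eq_zero_of_mem_newspace ⟨e, ?_⟩ ?_ (hB _ (Nat.div_dvd_of_dvd hde)) hx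
    · rw [mul_right_comm, Nat.mul_div_cancel' hde]
    · exact fun h => hne ((Nat.div_eq_self.1 h).resolve_left (NeZero.ne q))
  have one_mem : 1 ∈ q.divisors := Nat.one_mem_divisors.2 (NeZero.ne q)
  rw [isolator_apply, Finset.sum_eq_single_of_mem 1 one_mem, Finset.sum_eq_single_of_mem 1 one_mem]
  · rw [ArithmeticFunction.moebius_apply_one, Int.cast_one, one_smul, one_smul, mul_one,
      Nat.div_one]
    exact raisedProjection_apply_of_isCuspOn hV (one_mul q).dvd (hB q dvd_rfl)
      (by rw [levelGroup_one]; exact x.2)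
  · exact fun e he hne => moebius_smul_eq_zero fun hes =>
      vanish one_mem he squarefree_one hes (by rwa [one_mul])
  · exact fun d hd hne => moebius_smul_eq_zero fun hds => Finset.sum_eq_zero fun e he =>
      moebius_smul_eq_zero fun hes =>
        vanish hd he hds hes fun h => hne (Nat.eq_one_of_mul_eq_one_right h)

theorem frameOperator_newspace_eq_isolator (hV : 0 < V) {Bnew : Finset (ℍ → ℂ)}
    (hBnew : IsOrthonormalBasis V k q (newspace V k q) Bnew) :
    frameOperator (cuspInner V k q) Bnew (toCuspSpace k q) = isolator V k q B := by
  ext1 x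
  calc frameOperator (cuspInner V k q) Bnew (toCuspSpace k q) x
      = frameOperator (cuspInner V k q) Bnew (toCuspSpace k q) (isolator V k q B x) := by
        rw [frameOperator_apply, frameOperator_apply]
        refine Finset.sum_congr rfl fun φ hφ => ?_
        have hφnew := hBnew.mem hφ
        rw [← isolator_symm, isolator_apply_of_mem_newspace hcube hB hV]
        rwa [coe_toCuspSpace hφnew.1]
    _ = isolator V k q B x :=
        hBnew.frameOperator_apply (fun _ h => h.1) (isolator_mem_newspace hcube hB hV x)

theorem sum_diagonal_newspace_eq (hV : 0 < V) {Bnew : Finset (ℍ → ℂ)}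
    (hBnew : IsOrthonormalBasis V k q (newspace V k q) Bnew)
    (S : cuspSpace k q →ₗ⋆[ℂ] cuspSpace k q →ₗ[ℂ] ℂ) :
    ∑ φ ∈ Bnew, S (toCuspSpace k q φ) (toCuspSpace k q φ) =
      ∑ d ∈ q.divisors, ∑ e ∈ q.divisors, (moebius d : ℂ) * (moebius e : ℂ) *
        ∑ φ ∈ B (q / (d * e)),
          S (toCuspSpace k q (raise k d φ)) (toCuspSpace k q (raise k d φ)) := by
  have frame_eq_id : frameOperator (cuspInner V k q) (B q) (toCuspSpace k q) = LinearMap.id :=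
    LinearMap.ext fun x => (hB q dvd_rfl).frameOperator_apply subset_rfl x.2
  rw [← diagonalSum_frameOperator cuspInner_conj S frame_eq_id,
    frameOperator_newspace_eq_isolator hcube hB hV hBnew, isolator]
  simp only [map_sum, map_smul, raisedProjection, smul_eq_mul, mul_assoc, Finset.mul_sum,
    diagonalSum_frameOperator cuspInner_conj S frame_eq_id]

omit [NeZero q] in
theorem raise_mem_cuspSpace_of_moebius_ne_zero (hd : d ∈ q.divisors) (he : e ∈ q.divisors)
    (hne : moebius d * moebius e ≠ 0) {φ : ℍ → ℂ} (hφ : φ ∈ B (q / (d * e))) :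
    raise k d φ ∈ cuspSpace k q := by
  have hds := ArithmeticFunction.moebius_ne_zero_iff_squarefree.1 (left_ne_zero_of_mul hne)
  have hes := ArithmeticFunction.moebius_ne_zero_iff_squarefree.1 (right_ne_zero_of_mul hne)
  have hde := mul_dvd_of_squarefree hcube hds hes (Nat.dvd_of_mem_divisors hd)
    (Nat.dvd_of_mem_divisors he)
  refine raise_mem_cuspSpace hds.ne_zero ⟨e, ?_⟩ ((hB _ (Nat.div_dvd_of_dvd hde)).mem hφ)
  rw [mul_right_comm, Nat.mul_div_cancel' hde]

end Isolator

end Isolation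

end NewformIsolation

end

open NewformIsolation ArithmeticFunction in
theorem mainTheorem6_general (k : ℕ) {V : ℝ} (hV : 0 < V) (q : ℕ) [NeZero q]
    (hcube : ∀ p : ℕ, p.Prime → p ∣ q → p ^ 3 ∣ q) (T : (ℍ → ℂ) →ₗ[ℂ] ℍ → ℂ)
    (hT : ∀ φ ∈ cuspSpace k q, T φ ∈ boundedForms k) {Ψ : ℍ → ℂ} (hΨm : AEMeasurable Ψ)
    (hΨ : ModerateGrowth Ψ) {Bnew : Finset (ℍ → ℂ)}
    (hBnew : IsOrthonormalBasis V k q (newspace V k q) Bnew) {B : ℕ → Finset (ℍ → ℂ)}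
    (hB : ∀ ℓ, ℓ ∣ q → IsOrthonormalBasis V k ℓ (cuspSpace k ℓ) (B ℓ)) :
    (∀ φ ∈ Bnew, Integrable (petersson k φ (Ψ * T φ)) (levelMeasure V q)) ∧
    (∀ d ∈ q.divisors, ∀ e ∈ q.divisors, moebius d * moebius e ≠ 0 → ∀ φ ∈ B (q / (d * e)),
      Integrable (petersson k (raise k d φ) (Ψ * T (raise k d φ))) (levelMeasure V q)) ∧
    ∑ φ ∈ Bnew, peterssonInner V k q φ (Ψ * T φ) =
      ∑ d ∈ q.divisors, ∑ e ∈ q.divisors, (moebius d : ℂ) * (moebius e : ℂ) *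
        ∑ φ ∈ B (q / (d * e)),
          peterssonInner V k q (raise k d φ) (Ψ * T (raise k d φ)) := by
  have integrable {f g : ℍ → ℂ} (hf : f ∈ cuspSpace k q) (hg : g ∈ cuspSpace k q) :
      Integrable (petersson k f (Ψ * T g)) (levelMeasure V q) :=
    integrable_petersson_mul V hf (hT g hg) hΨm hΨ
  let S := innerForm V k q (LinearMap.mulLeft ℂ Ψ ∘ₗ T ∘ₗ (cuspSpace k q).subtype)
    fun f g => integrable f.2 g.2
  have S_apply {f : ℍ → ℂ} (hf : f ∈ cuspSpace k q) :
      S (toCuspSpace k q f) (toCuspSpace k q f) = peterssonInner V k q f (Ψ * T f) := by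
    rw [toCuspSpace_of_mem hf]
    rfl
  have mem_of_ne {d e : ℕ} (hd : d ∈ q.divisors) (he : e ∈ q.divisors)
      (hne : moebius d * moebius e ≠ 0) : ∀ φ ∈ B (q / (d * e)), raise k d φ ∈ cuspSpace k q :=
    fun φ hφ => raise_mem_cuspSpace_of_moebius_ne_zero hcube hB hd he hne hφ
  refine ⟨fun φ hφ => integrable (hBnew.mem hφ).1 (hBnew.mem hφ).1, fun d hd e he hne φ hφ =>
    integrable (mem_of_ne hd he hne φ hφ) (mem_of_ne hd he hne φ hφ), ?_⟩
  rw [← Finset.sum_congr rfl fun φ hφ => S_apply (hBnew.mem hφ).1,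
    sum_diagonal_newspace_eq hcube hB hV hBnew S]
  refine Finset.sum_congr rfl fun d hd => Finset.sum_congr rfl fun e he => ?_
  rcases eq_or_ne (moebius d * moebius e) 0 with h0 | hne
  · rw [← Int.cast_mul, h0, Int.cast_zero, zero_mul, zero_mul]
  · rw [Finset.sum_congr rfl fun φ hφ => S_apply (mem_of_ne hd he hne φ hφ)]

theorem mainTheorem6 (k : ℕ) (hk : 0 < k) (V : ℝ) (hV : 0 < V)
    (q : ℕ) (hq : 0 < q) (hcube : ∀ p : ℕ, p.Prime → p ∣ q → p ^ 3 ∣ q)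
    (n : ℕ) (hn : 0 < n) (hnq : Nat.Coprime n q)
    (Ψ : ℍ → ℂ) (hΨmeas : AEMeasurable Ψ (volume : Measure ℍ))
    (hΨinv : ∀ γ ∈ CongruenceSubgroup.Gamma0 q, ∀ z : ℍ, Ψ (γ • z) = Ψ z)
    (hΨgrowth : NewformIsolation.ModerateGrowth Ψ)
    (Bnew : Finset (ℍ → ℂ))
    (hBnew : NewformIsolation.IsOrthonormalBasis V k q (NewformIsolation.newspace V k q) Bnew)
    (B : ℕ → Finset (ℍ → ℂ))
    (hB : ∀ ℓ : ℕ, ℓ ∣ q → NewformIsolation.IsOrthonormalBasis V k ℓ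
      (NewformIsolation.cuspSpace k ℓ : Set (ℍ → ℂ)) (B ℓ)) :
    -- all the integrals that occur converge absolutely
    (∀ φ ∈ Bnew, Integrable (petersson (k : ℤ) φ (Ψ * NewformIsolation.hecke k n φ))
      (NewformIsolation.levelMeasure V q)) ∧
    (∀ d ∈ q.divisors, ∀ e ∈ q.divisors,
      ArithmeticFunction.moebius d * ArithmeticFunction.moebius e ≠ 0 →
      ∀ φ ∈ B (q / (d * e)),
        Integrable (petersson (k : ℤ) (NewformIsolation.raise k d φ)
          (Ψ * NewformIsolation.hecke k n (NewformIsolation.raise k d φ)))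
          (NewformIsolation.levelMeasure V q)) ∧
    ∑ φ ∈ Bnew, NewformIsolation.peterssonInner V k q φ (Ψ * NewformIsolation.hecke k n φ) =
      ∑ d ∈ q.divisors, ∑ e ∈ q.divisors,
        (ArithmeticFunction.moebius d : ℂ) * (ArithmeticFunction.moebius e : ℂ) *
          ∑ φ ∈ B (q / (d * e)),
            NewformIsolation.peterssonInner V k q (NewformIsolation.raise k d φ)
              (Ψ * NewformIsolation.hecke k n (NewformIsolation.raise k d φ)) := by
  have : NeZero q := ⟨hq.ne'⟩
  exact mainTheorem6_general k hV q hcube (NewformIsolation.heckeHom k n)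
    (fun φ hφ => NewformIsolation.hecke_mem_boundedForms
      (NewformIsolation.cuspSpace_le_boundedForms k q hφ) n) hΨmeas hΨgrowth hBnew hB
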